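/- Let $KS_0$ be the equilateral triangle with vertices $0,\,1,\,e^{i\pi/3}$, and let $KS_{n+1}$ be the polygon obtained from $KS_n$ by replacing the open middle third (the ghost) of each side by the other two sides of the equilateral triangle erected outwards on it. Let $\Omega(KS_n)$ be the closed region bounded by $KS_n$, considered as a billiard table. The small closed triangles that are glued to $\Omega(KS_{n-1})$ to form $\Omega(KS_n)$ are the cells of $\Omega(KS_n)$. A periodic orbit of $\Omega(KS_n)$ is a closed billiard orbit that hits no vertex of $KS_n$. It is recorded by its successive basepoints on $KS_n$ with the inward unit directions there; its period $\#\mathscr O$ is the least number of reflections after which basepoint and direction recur, and its length $|\mathscr O|$ is the length of the closed path that connects consecutive basepoints over one period. For each $n\ge 0$ let $\mathscr O_n$ be a periodic orbit of $\Omega(KS_n)$ with initial basepoint $x_n^0\in KS_n$ and initial direction $\pi/3$ (with respect to the fixed coordinate axes). Suppose that these orbits are compatible: for every $n$, the point $x_0^0$ lies on the ray from $x_n^0$ in the direction $\pi/3$, and the open segment between $x_n^0$ and $x_0^0$ (empty if $x_n^0=x_0^0$) lies in $\Omega(KS_n)$ and contains no point of $KS_n$. Suppose moreover that $(\mathscr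 O_n)_{n\ge 0}$ is a compatible sequence of piecewise Fagnano orbits: for all sufficiently large $n$, the point $x_n^0$ is the midpoint of a side of $KS_n$ that is a side of a cell of $\Omega(KS_n)$. Let $\mathscr L$ be the length of the Fagnano orbit of $\Omega(KS_0)$, that is, of the periodic orbit starting at the midpoint $1/2$ of the base in the direction $\pi/3$. Then the sequence of path lengths $(|\mathscr O_n|)_{n\ge 0}$ is monotonically increasing (in the weak sense), the limit $\lim_{n\to\infty}|\mathscr O_n|$ exists and is finite, $\lim_{n\to\infty}|\mathscr O_n|\le 4\mathscr L$, and $\lim_{n\to\infty}\#\mathscr O_n=\infty$. -/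

import Mathlib

open Filter Topology

namespace KochBilliard

noncomputable section

/-- The plane is identified with `ℂ`. This is the unit vector in the direction `π/3`; it is also the
top vertex of the equilateral triangle whose base is the unit interval. -/
def dirPiThird : ℂ := Complex.exp ((Real.pi / 3 : ℝ) * Complex.I)

/-- Left endpoint of the open middle third (the ghost) of the side from `s.1` to `s.2`. -/
def ghostLeft (s : ℂ × ℂ) : ℂ := s.1 + (s.2 - s.1) / 3

/-- Right endpoint of the ghost of the side from `s.1` to `s.2`. -/
def ghostRight (s : ℂ × ℂ) : ℂ := s.1 + 2 * (s.2 - s.1) / 3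

/-- Third vertex of the equilateral triangle that is glued to the middle third of the side `s`.
Sides are directed counterclockwise, so the outside of the polygon lies to their right. -/
def apex (s : ℂ × ℂ) : ℂ :=
  ghostLeft s + (s.2 - s.1) / 3 * (starRingEnd ℂ) dirPiThird

/-- The `3 * 4 ^ n` sides of the `n`-th Koch snowflake prefractal polygon `KS_n`, as pairs of
endpoints, listed counterclockwise. `KS_0` is the equilateral triangle with base `[0, 1]`. -/
def sides : ℕ → List (ℂ × ℂ)
  | 0 => [(0, 1), (1, dirPiThird), (dirPiThird, 0)]
  | n + 1 => (sides n).flatMap fun s =>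
      [(s.1, ghostLeft s), (ghostLeft s, apex s), (apex s, ghostRight s), (ghostRight s, s.2)]

/-- The polygonal curve `KS_n`. -/
def curve (n : ℕ) : Set ℂ := {z | ∃ s ∈ sides n, z ∈ segment ℝ s.1 s.2}

/-- The closed triangular region glued to the middle third of the side `s`. -/
def cell (s : ℂ × ℂ) : Set ℂ := convexHull ℝ {ghostLeft s, apex s, ghostRight s}

/-- The billiard table `Ω(KS_n)`: the closed region bounded by `KS_n`. -/
def table : ℕ → Set ℂ
  | 0 => convexHull ℝ {0, 1, dirPiThird}
  | n + 1 => table n ∪ ⋃ s ∈ sides n, cell s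

/-- One application of the billiard map of `Ω(KS_n)` to a pair (basepoint, inward direction):
the ball moves in the interior of the table until its first collision with `KS_n`, which is not
at a vertex, and the direction is then reflected in the side that was hit. -/
def BilliardStep (n : ℕ) (p q : ℂ × ℂ) : Prop :=
  (∃ t : ℝ, 0 < t ∧ q.1 = p.1 + (t : ℂ) * p.2 ∧
    ∀ r ∈ Set.Ioo 0 t, p.1 + (r : ℂ) * p.2 ∈ table n \ curve n) ∧
  ∃ s ∈ sides n, q.1 ∈ openSegment ℝ s.1 s.2 ∧
    q.2 = (Submodule.span ℝ {s.2 - s.1}).reflection p.2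

/-- `z` is a nonsingular orbit of `Ω(KS_n)`: `z k` is the `k`-th basepoint together with the inward
unit direction at that point, and no basepoint is a vertex. -/
structure IsOrbit (n : ℕ) (z : ℕ → ℂ × ℂ) : Prop where
  start_mem : ∃ s ∈ sides n, (z 0).1 ∈ openSegment ℝ s.1 s.2
  unit : ‖(z 0).2‖ = 1
  step : ∀ k, BilliardStep n (z k) (z (k + 1))

/-- A periodic orbit: a nonsingular orbit that closes up. -/
def IsPeriodicOrbit (n : ℕ) (z : ℕ → ℂ × ℂ) : Prop :=
  IsOrbit n z ∧ ∃ p : ℕ, 0 < p ∧ z p = z 0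

/-- The (least) period of a periodic orbit. -/
def period (z : ℕ → ℂ × ℂ) : ℕ := sInf {p | 0 < p ∧ z p = z 0}

/-- The length of the closed path that connects consecutive basepoints of a periodic orbit. -/
def pathLength (z : ℕ → ℂ × ℂ) : ℝ :=
  ∑ k ∈ Finset.range (period z), dist (z k).1 (z (k + 1)).1

/-- `O n` is a periodic orbit of `Ω(KS_n)` for every `n`, all orbits have the initial direction `v`,
and the initial basepoint of `O n` is joined to that of `O 0` by a (possibly degenerate) segment in
the direction `v` that runs inside `Ω(KS_n)` and has no point of `KS_n` between its endpoints. -/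
structure IsCompatiblePeriodic (v : ℂ) (O : ℕ → ℕ → ℂ × ℂ) : Prop where
  periodic : ∀ n, IsPeriodicOrbit n (O n)
  direction : ∀ n, (O n 0).2 = v
  collinear : ∀ n, ∃ t : ℝ, 0 ≤ t ∧ (O n 0).1 + (t : ℂ) * v = (O 0 0).1 ∧
    ∀ r ∈ Set.Ioo 0 t, (O n 0).1 + (r : ℂ) * v ∈ table n \ curve n

/-- A compatible sequence of periodic orbits such that, from some level on, the initial basepoint
is the midpoint of a side of `KS_(n+1)` that belongs to a cell glued on when passing from `KS_n` to
`KS_(n+1)`. -/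
structure IsCompatiblePiecewiseFagnano (v : ℂ) (O : ℕ → ℕ → ℂ × ℂ) : Prop
    extends IsCompatiblePeriodic v O where
  midpoints : ∃ N : ℕ, ∀ n ≥ N, ∃ s ∈ sides n,
    (O (n + 1) 0).1 = midpoint ℝ (ghostLeft s) (apex s) ∨
    (O (n + 1) 0).1 = midpoint ℝ (apex s) (ghostRight s)

/-- `F` is the Fagnano orbit of the equilateral triangle `Ω(KS_0)`: the periodic orbit that starts
at the midpoint of the base in the direction `π/3`. -/
def IsFagnanoOrbit (F : ℕ → ℂ × ℂ) : Prop :=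
  IsPeriodicOrbit 0 F ∧ F 0 = (1 / 2, dirPiThird)

end

end KochBilliard

namespace KochBilliard

noncomputable section

/-! All flights run in directions of the triangular lattice, so a ball that crosses a side of an
earlier polygon makes an excursion into what is glued there and comes back as if mirrored by that
side, only at another point. If it leaves at parameter `u`, it returns at `mirror k u`, where `k` is
the number of later subdivisions. Ternary digits 0 and 2 of `u` mean that an outer third is met and
the excursion happens one level deeper. A digit 1 means that the ball passes the ghost, makes one
excursion through each free side of the cell and leaves symmetrically at `1 - u`. `transit_side`
proves this by recursion on the digits and records the reflections (`bounces`, doubled by each digit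
1) and the length (`excess`).

In the initial triangle a ball entering at foot `x` of the base makes one excursion through each of
the three sides and enters again at `1 - mirror n x` (`round`). This map is an involution, so the
orbit closes after one turn if it fixes `x` and after two otherwise. This gives the explicit length
`orbitLength` and the bound `3 * bounces n x` for the period (`pathLength_period`).

Compatibility gives all orbits the same foot `x`. The digits of the excess recursion make the length
monotone and at most 6, which is four times the Fagnano length 3/2 (`orbitLength_mono_le`,
`pathLength_fagnano`). A midpoint start makes `x` a half-integral multiple of a power of 1/3, so its
digits are eventually all 1 and the number of reflections grows exponentially (`half_of_midpoint`,
`two_pow_le_bounces`). -/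

/-- The unit vector in the direction `-π/3`. -/
def eta : ℂ := (starRingEnd ℂ) dirPiThird

lemma dirPiThird_eq : dirPiThird = ⟨1 / 2, √3 / 2⟩ := by
  apply Complex.ext
  · simp [dirPiThird, Complex.exp_re]
  · simp [dirPiThird, Complex.exp_im]

lemma eta_eq : eta = ⟨1 / 2, -(√3 / 2)⟩ := by
  rw [eta, dirPiThird_eq]; apply Complex.ext <;> simp

lemma eta_sq : eta * eta = eta - 1 := by
  have h : √3 * √3 = 3 := Real.mul_self_sqrt (by norm_num)
  rw [eta_eq]
  apply Complex.ext
  · simp; nlinarith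
  · simp; ring

lemma dirPiThird_eq_one_sub_eta : dirPiThird = 1 - eta := by
  rw [eta_eq, dirPiThird_eq]
  apply Complex.ext
  · simp; norm_num
  · simp

lemma apex_eq (s : ℂ × ℂ) : apex s = ghostLeft s + (s.2 - s.1) / 3 * eta := rfl

lemma conj_eta : (starRingEnd ℂ) eta = 1 - eta := by
  rw [eta, Complex.conj_conj, ← eta, dirPiThird_eq_one_sub_eta]

lemma ofReal_add_mul_eta_inj {x y x' y' : ℝ} (h : (x : ℂ) + y * eta = x' + y' * eta) :
    x = x' ∧ y = y' := by
  have h3 : 0 < √3 := Real.sqrt_pos.mpr (by norm_num)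
  rw [eta_eq] at h
  have h1 := congrArg Complex.re h
  have h2 := congrArg Complex.im h
  simp at h1 h2
  have hy : y = y' := h2
  subst hy
  exact ⟨by linarith, rfl⟩

/-! ### Affine frames of the sides and the triangular lattice -/

/-- The point with coordinates `x`, `y` in the affine frame attached to the side `s`: the first
axis runs along `s`, the second one points outwards at the angle `-π/3`. -/
def pt (s : ℂ × ℂ) (x y : ℝ) : ℂ := s.1 + (s.2 - s.1) * (x + y * eta)

/-- The vector with coordinates `a`, `b` in the frame of the side `s`, magnified by `3 ^ m`. -/
def dir (s : ℂ × ℂ) (m : ℕ) (a b : ℝ) : ℂ := 3 ^ m * (s.2 - s.1) * (a + b * eta)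

lemma pt_inj {s : ℂ × ℂ} (hs : s.2 - s.1 ≠ 0) {x y x' y' : ℝ} (h : pt s x y = pt s x' y') :
    x = x' ∧ y = y' :=
  ofReal_add_mul_eta_inj (mul_left_cancel₀ hs (add_left_cancel h))

lemma pt_add_dir (s : ℂ × ℂ) (m : ℕ) (x y a b r : ℝ) :
    pt s x y + (r : ℂ) * dir s m a b = pt s (x + 3 ^ m * r * a) (y + 3 ^ m * r * b) := by
  simp only [pt, dir]; push_cast; ring

/-- The four sides that replace `s` at the next level. -/
def child₁ (s : ℂ × ℂ) : ℂ × ℂ := (s.1, ghostLeft s)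
def child₂ (s : ℂ × ℂ) : ℂ × ℂ := (ghostLeft s, apex s)
def child₃ (s : ℂ × ℂ) : ℂ × ℂ := (apex s, ghostRight s)
def child₄ (s : ℂ × ℂ) : ℂ × ℂ := (ghostRight s, s.2)

lemma child₁_sub (s : ℂ × ℂ) : (child₁ s).2 - (child₁ s).1 = (s.2 - s.1) / 3 := by
  simp only [child₁, ghostLeft]; ring

lemma child₂_sub (s : ℂ × ℂ) : (child₂ s).2 - (child₂ s).1 = (s.2 - s.1) / 3 * eta := by
  simp only [child₂, ghostLeft, apex_eq]; ring

lemma child₃_sub (s : ℂ × ℂ) : (child₃ s).2 - (child₃ s).1 = (s.2 - s.1) / 3 * (1 - eta) := by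
  simp only [child₃, ghostLeft, ghostRight, apex_eq]; ring

lemma child₄_sub (s : ℂ × ℂ) : (child₄ s).2 - (child₄ s).1 = (s.2 - s.1) / 3 := by
  simp only [child₄, ghostRight]; ring

lemma pt_child₁ (s : ℂ × ℂ) (x y : ℝ) : pt (child₁ s) x y = pt s (x / 3) (y / 3) := by
  rw [pt, child₁_sub]; simp only [child₁, pt]; push_cast; ring

lemma pt_child₂ (s : ℂ × ℂ) (x y : ℝ) :
    pt (child₂ s) x y = pt s ((1 - y) / 3) ((x + y) / 3) := by
  rw [pt, child₂_sub]; simp only [child₂, pt, ghostLeft]; push_cast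
  linear_combination (s.2 - s.1) / 3 * y * eta_sq

lemma pt_child₃ (s : ℂ × ℂ) (x y : ℝ) :
    pt (child₃ s) x y = pt s ((1 + x + y) / 3) ((1 - x) / 3) := by
  rw [pt, child₃_sub]; simp only [child₃, pt, apex_eq, ghostLeft]; push_cast
  linear_combination -(s.2 - s.1) / 3 * y * eta_sq

lemma pt_child₄ (s : ℂ × ℂ) (x y : ℝ) : pt (child₄ s) x y = pt s ((2 + x) / 3) (y / 3) := by
  rw [pt, child₄_sub]; simp only [child₄, pt, ghostRight]; push_cast; ring

lemma dir_child₁ (s : ℂ × ℂ) (m : ℕ) (a b : ℝ) : dir (child₁ s) (m + 1) a b = dir s m a b := by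
  rw [dir, child₁_sub, dir]; ring

lemma dir_child₂ (s : ℂ × ℂ) (m : ℕ) (a b : ℝ) :
    dir (child₂ s) (m + 1) a b = dir s m (-b) (a + b) := by
  rw [dir, child₂_sub, dir]; push_cast
  linear_combination 3 ^ m * (s.2 - s.1) * b * eta_sq

lemma dir_child₃ (s : ℂ × ℂ) (m : ℕ) (a b : ℝ) :
    dir (child₃ s) (m + 1) a b = dir s m (a + b) (-a) := by
  rw [dir, child₃_sub, dir]; push_cast
  linear_combination -3 ^ m * (s.2 - s.1) * b * eta_sq

lemma dir_child₄ (s : ℂ × ℂ) (m : ℕ) (a b : ℝ) : dir (child₄ s) (m + 1) a b = dir s m a b := by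
  rw [dir, child₄_sub, dir]; ring

lemma mem_sides_succ {n : ℕ} {s : ℂ × ℂ} : s ∈ sides (n + 1) ↔
    ∃ p ∈ sides n, s = child₁ p ∨ s = child₂ p ∨ s = child₃ p ∨ s = child₄ p := by
  simp [sides, child₁, child₂, child₃, child₄]

lemma child₁_mem {n : ℕ} {s : ℂ × ℂ} (h : s ∈ sides n) : child₁ s ∈ sides (n + 1) :=
  mem_sides_succ.mpr ⟨s, h, by simp⟩

lemma child₂_mem {n : ℕ} {s : ℂ × ℂ} (h : s ∈ sides n) : child₂ s ∈ sides (n + 1) :=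
  mem_sides_succ.mpr ⟨s, h, by simp⟩

lemma child₃_mem {n : ℕ} {s : ℂ × ℂ} (h : s ∈ sides n) : child₃ s ∈ sides (n + 1) :=
  mem_sides_succ.mpr ⟨s, h, by simp⟩

lemma child₄_mem {n : ℕ} {s : ℂ × ℂ} (h : s ∈ sides n) : child₄ s ∈ sides (n + 1) :=
  mem_sides_succ.mpr ⟨s, h, by simp⟩

/-- The base, the right side and the left side of `KS_0`. -/
def base : ℂ × ℂ := (0, 1)
def rightSide : ℂ × ℂ := (1, dirPiThird)
def leftSide : ℂ × ℂ := (dirPiThird, 0)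

lemma mem_sides_zero {s : ℂ × ℂ} :
    s ∈ sides 0 ↔ s = base ∨ s = rightSide ∨ s = leftSide := by
  simp [sides, base, rightSide, leftSide]

lemma base_mem : base ∈ sides 0 := mem_sides_zero.mpr (by simp)
lemma rightSide_mem : rightSide ∈ sides 0 := mem_sides_zero.mpr (by simp)
lemma leftSide_mem : leftSide ∈ sides 0 := mem_sides_zero.mpr (by simp)

lemma pt_base (x y : ℝ) : pt base x y = x + y * eta := by simp [pt, base]

lemma dir_base (a b : ℝ) : dir base 0 a b = a + b * eta := by simp [dir, base]

lemma pt_rightSide (x y : ℝ) : pt rightSide x y = pt base (1 + y) (-(x + y)) := by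
  rw [pt_base]; simp only [pt, rightSide, dirPiThird_eq_one_sub_eta]; push_cast
  linear_combination -(y : ℂ) * eta_sq

lemma pt_leftSide (x y : ℝ) : pt leftSide x y = pt base (1 - x - y) (x - 1) := by
  rw [pt_base]; simp only [pt, leftSide, dirPiThird_eq_one_sub_eta]; push_cast
  linear_combination (y : ℂ) * eta_sq

lemma dir_rightSide (a b : ℝ) : dir rightSide 0 a b = dir base 0 b (-(a + b)) := by
  rw [dir_base]; simp only [dir, rightSide, dirPiThird_eq_one_sub_eta]; push_cast
  linear_combination -(b : ℂ) * eta_sq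

lemma dir_leftSide (a b : ℝ) : dir leftSide 0 a b = dir base 0 (-(a + b)) a := by
  rw [dir_base]; simp only [dir, leftSide, dirPiThird_eq_one_sub_eta]; push_cast
  linear_combination (b : ℂ) * eta_sq

lemma dirPiThird_eq_dir : dirPiThird = dir base 0 1 (-1) := by
  rw [dir_base, dirPiThird_eq_one_sub_eta]; push_cast; ring

/-- In lattice coordinates of mesh `3 ^ (-n)`, the sides of `KS_n` are unit edges of the
triangular lattice. -/
lemma sides_lattice {n : ℕ} {s : ℂ × ℂ} (h : s ∈ sides n) : ∃ p q a b : ℤ,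
    3 ^ n * s.1 = p + q * eta ∧ 3 ^ n * (s.2 - s.1) = a + b * eta ∧
    a ^ 2 + a * b + b ^ 2 = 1 := by
  induction n generalizing s with
  | zero =>
    rcases mem_sides_zero.mp h with rfl | rfl | rfl
    · exact ⟨0, 0, 1, 0, by simp [base], by simp [base], by norm_num⟩
    · refine ⟨1, 0, 0, -1, by simp [rightSide], ?_, by norm_num⟩
      simp [rightSide, dirPiThird_eq_one_sub_eta]
    · refine ⟨1, -1, -1, 1, ?_, ?_, by norm_num⟩ <;>
      simp [leftSide, dirPiThird_eq_one_sub_eta] <;> ring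
  | succ n ih =>
    obtain ⟨p, hp, hs⟩ := mem_sides_succ.mp h
    obtain ⟨u, v, a, b, h1, h2, h3⟩ := ih hp
    rcases hs with rfl | rfl | rfl | rfl
    · refine ⟨3 * u, 3 * v, a, b, ?_, ?_, h3⟩
      · simp only [child₁]; push_cast; linear_combination 3 * h1
      · rw [child₁_sub]; linear_combination h2
    -- By `eta_sq`, multiplication by `eta` sends the coordinates `(a, b)` to `(-b, a + b)`, which
    -- preserves the norm form.
    · refine ⟨3 * u + a, 3 * v + b, -b, a + b, ?_, ?_, by linarith⟩
      · simp only [child₂, ghostLeft]; push_cast; linear_combination 3 * h1 + h2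
      · rw [child₂_sub]; push_cast; linear_combination eta * h2 + b * eta_sq
    · refine ⟨3 * u + a - b, 3 * v + a + 2 * b, a + b, -a, ?_, ?_, by linarith⟩
      · simp only [child₃, apex_eq, ghostLeft]; push_cast
        linear_combination 3 * h1 + h2 + eta * h2 + b * eta_sq
      · rw [child₃_sub]; push_cast; linear_combination (1 - eta) * h2 - b * eta_sq
    · refine ⟨3 * u + 2 * a, 3 * v + 2 * b, a, b, ?_, ?_, h3⟩
      · simp only [child₄, ghostRight]; push_cast; linear_combination 3 * h1 + 2 * h2
      · rw [child₄_sub]; linear_combination h2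

lemma sides_sub_ne_zero {n : ℕ} {s : ℂ × ℂ} (h : s ∈ sides n) : s.2 - s.1 ≠ 0 := by
  obtain ⟨p, q, a, b, -, h2, h3⟩ := sides_lattice h
  intro h0
  rw [h0, mul_zero] at h2
  have := ofReal_add_mul_eta_inj (x := 0) (y := 0) (x' := a) (y' := b) (by push_cast; simpa using h2)
  obtain ⟨ha, hb⟩ := this
  have ha' : a = 0 := by exact_mod_cast ha.symm
  have hb' : b = 0 := by exact_mod_cast hb.symm
  simp [ha', hb'] at h3

/-! ### Nested hulls, and where the curve and the table cannot be -/

/-- The closed triangle on the outside of `s` that contains everything later glued to `s`. -/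
def hull (s : ℂ × ℂ) : Set ℂ := {z | ∃ x y : ℝ, z = pt s x y ∧ 0 ≤ y ∧ y ≤ x ∧ x + 2 * y ≤ 1}

/-- The interior of `hull s` together with the open side `s`. -/
def halfOpenHull (s : ℂ × ℂ) : Set ℂ :=
  {z | ∃ x y : ℝ, z = pt s x y ∧ 0 ≤ y ∧ y < x ∧ x + 2 * y < 1}

/-- The interior of `hull s`. -/
def openHull (s : ℂ × ℂ) : Set ℂ :=
  {z | ∃ x y : ℝ, z = pt s x y ∧ 0 < y ∧ y < x ∧ x + 2 * y < 1}

/-- The interior of the cell glued to `s` together with the ghost of `s`. -/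
def halfOpenCell (s : ℂ × ℂ) : Set ℂ :=
  {z | ∃ x y : ℝ, z = pt s x y ∧ 0 ≤ y ∧ 1 / 3 < x ∧ x + y < 2 / 3}

/-- The interior of the triangle `Ω(KS_0)`. -/
def openTriangle : Set ℂ := {z | ∃ x y : ℝ, z = pt base x y ∧ y < 0 ∧ x < 1 ∧ 0 < x + y}

lemma openHull_subset (s : ℂ × ℂ) : openHull s ⊆ halfOpenHull s :=
  fun _ ⟨x, y, h, h0, h1, h2⟩ => ⟨x, y, h, h0.le, h1, h2⟩

lemma halfOpenCell_subset (s : ℂ × ℂ) : halfOpenCell s ⊆ halfOpenHull s :=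
  fun _ ⟨x, y, h, h0, h1, h2⟩ => ⟨x, y, h, h0, by linarith, by linarith⟩

/-- `c` is one of the four sides that replace `s`. -/
def IsChild (c s : ℂ × ℂ) : Prop := c = child₁ s ∨ c = child₂ s ∨ c = child₃ s ∨ c = child₄ s

lemma hull_child_subset {c s : ℂ × ℂ} (h : IsChild c s) : hull c ⊆ hull s := by
  rintro z ⟨x, y, rfl, h0, h1, h2⟩
  rcases h with rfl | rfl | rfl | rfl
  · exact ⟨_, _, pt_child₁ s x y, by linarith, by linarith, by linarith⟩
  · exact ⟨_, _, pt_child₂ s x y, by linarith, by linarith, by linarith⟩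
  · exact ⟨_, _, pt_child₃ s x y, by linarith, by linarith, by linarith⟩
  · exact ⟨_, _, pt_child₄ s x y, by linarith, by linarith, by linarith⟩

lemma halfOpenHull_child_subset {c s : ℂ × ℂ} (h : IsChild c s) :
    halfOpenHull c ⊆ halfOpenHull s := by
  rintro z ⟨x, y, rfl, h0, h1, h2⟩
  rcases h with rfl | rfl | rfl | rfl
  · exact ⟨_, _, pt_child₁ s x y, by linarith, by linarith, by linarith⟩
  · exact ⟨_, _, pt_child₂ s x y, by linarith, by linarith, by linarith⟩
  · exact ⟨_, _, pt_child₃ s x y, by linarith, by linarith, by linarith⟩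
  · exact ⟨_, _, pt_child₄ s x y, by linarith, by linarith, by linarith⟩

lemma openHull_child_subset {c s : ℂ × ℂ} (h : IsChild c s) : openHull c ⊆ openHull s := by
  rintro z ⟨x, y, rfl, h0, h1, h2⟩
  rcases h with rfl | rfl | rfl | rfl
  · exact ⟨_, _, pt_child₁ s x y, by linarith, by linarith, by linarith⟩
  · exact ⟨_, _, pt_child₂ s x y, by linarith, by linarith, by linarith⟩
  · exact ⟨_, _, pt_child₃ s x y, by linarith, by linarith, by linarith⟩
  · exact ⟨_, _, pt_child₄ s x y, by linarith, by linarith, by linarith⟩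

lemma eq_or_disjoint_of_isChild {c c' s : ℂ × ℂ} (hs : s.2 - s.1 ≠ 0) (h : IsChild c s)
    (h' : IsChild c' s) : c = c' ∨ Disjoint (halfOpenHull c) (hull c') := by
  by_cases hc : c = c'
  · exact Or.inl hc
  refine Or.inr (Set.disjoint_left.mpr ?_)
  rintro z ⟨x, y, rfl, h0, h1, h2⟩ ⟨x', y', hz, h0', h1', h2'⟩
  rcases h with rfl | rfl | rfl | rfl <;> rcases h' with rfl | rfl | rfl | rfl <;>
  first
  | exact hc rfl
  | (simp only [pt_child₁, pt_child₂, pt_child₃, pt_child₄] at hz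
     obtain ⟨hx, hy⟩ := pt_inj hs hz
     linarith)

/-- Hulls of children lie in the hull of the parent, so disjointness is inherited from distinct
parents. Only siblings and the three initial sides need a direct check, by linear inequalities in a
common frame. -/
lemma eq_or_disjoint {n : ℕ} {s s' : ℂ × ℂ} (h : s ∈ sides n) (h' : s' ∈ sides n) :
    s = s' ∨ Disjoint (halfOpenHull s) (hull s') := by
  induction n generalizing s s' with
  | zero =>
    by_cases hc : s = s'
    · exact Or.inl hc
    refine Or.inr (Set.disjoint_left.mpr ?_)
    rintro z ⟨x, y, rfl, h0, h1, h2⟩ ⟨x', y', hz, h0', h1', h2'⟩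
    rcases mem_sides_zero.mp h with rfl | rfl | rfl <;>
    rcases mem_sides_zero.mp h' with rfl | rfl | rfl <;>
    first
    | exact hc rfl
    | (try simp only [pt_rightSide, pt_leftSide] at hz
       obtain ⟨hx, hy⟩ := pt_inj (sides_sub_ne_zero base_mem) hz
       linarith)
  | succ n ih =>
    obtain ⟨p, hp, hs⟩ := mem_sides_succ.mp h
    obtain ⟨p', hp', hs'⟩ := mem_sides_succ.mp h'
    rcases ih hp hp' with rfl | hd
    · exact eq_or_disjoint_of_isChild (sides_sub_ne_zero hp) hs hs'
    · exact Or.inr (hd.mono (halfOpenHull_child_subset hs) (hull_child_subset hs'))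

lemma eq_of_mem_halfOpenHull {n : ℕ} {s s' : ℂ × ℂ} (h : s ∈ sides n) (h' : s' ∈ sides n) {z : ℂ}
    (hz : z ∈ halfOpenHull s) (hz' : z ∈ hull s') : s = s' :=
  (eq_or_disjoint h h').resolve_right fun hd => Set.disjoint_left.mp hd hz hz'

lemma segment_subset_hull (s : ℂ × ℂ) : segment ℝ s.1 s.2 ⊆ hull s := by
  rw [segment_eq_image']
  rintro _ ⟨t, ⟨h0, h1⟩, rfl⟩
  exact ⟨t, 0, by simp [pt, mul_comm], le_rfl, h0, by linarith⟩

lemma mem_openSegment_iff {s : ℂ × ℂ} {z : ℂ} :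
    z ∈ openSegment ℝ s.1 s.2 ↔ ∃ u : ℝ, 0 < u ∧ u < 1 ∧ z = pt s u 0 := by
  rw [openSegment_eq_image']
  constructor
  · rintro ⟨t, ⟨h0, h1⟩, rfl⟩
    exact ⟨t, h0, h1, by simp [pt, mul_comm]⟩
  · rintro ⟨t, h0, h1, rfl⟩
    exact ⟨t, ⟨h0, h1⟩, by simp [pt, mul_comm]⟩

lemma openSegment_subset_halfOpenHull (s : ℂ × ℂ) :
    openSegment ℝ s.1 s.2 ⊆ halfOpenHull s := by
  intro z hz
  obtain ⟨u, h0, h1, rfl⟩ := mem_openSegment_iff.mp hz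
  exact ⟨u, 0, rfl, le_rfl, h0, by linarith⟩

lemma mem_curve_of_mem_openSegment {n : ℕ} {s : ℂ × ℂ} (hs : s ∈ sides n) {z : ℂ}
    (hz : z ∈ openSegment ℝ s.1 s.2) : z ∈ curve n :=
  ⟨s, hs, openSegment_subset_segment ℝ _ _ hz⟩

lemma exists_hull_of_mem_hull {m n : ℕ} (hmn : m ≤ n) {s : ℂ × ℂ} (hs : s ∈ sides n) :
    ∃ s' ∈ sides m, hull s ⊆ hull s' := by
  induction n, hmn using Nat.le_induction generalizing s with
  | base => exact ⟨s, hs, subset_rfl⟩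
  | succ n _ ih =>
    obtain ⟨p, hp, hsp⟩ := mem_sides_succ.mp hs
    obtain ⟨s', hs', h⟩ := ih hp
    exact ⟨s', hs', (hull_child_subset hsp).trans h⟩

lemma exists_mem_hull_of_mem_curve {m n : ℕ} (hmn : m ≤ n) {z : ℂ} (hz : z ∈ curve n) :
    ∃ s ∈ sides m, z ∈ hull s := by
  obtain ⟨s, hs, h⟩ := hz
  obtain ⟨s', hs', h'⟩ := exists_hull_of_mem_hull hmn hs
  exact ⟨s', hs', h' (segment_subset_hull s h)⟩

/-- Later curves stay in the hulls of the level `m + 1` sides. Those coming from other parents miss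
the half-open hull of `s`, and the hulls of the four children of `s` avoid the ghost and the
interior of the cell. Flights across a cell are therefore never obstructed. -/
lemma notMem_curve_of_mem_halfOpenCell {m n : ℕ} (hmn : m + 1 ≤ n) {s : ℂ × ℂ} (hs : s ∈ sides m)
    {z : ℂ} (hz : z ∈ halfOpenCell s) : z ∉ curve n := by
  intro hc
  obtain ⟨c, hc, hzc⟩ := exists_mem_hull_of_mem_curve hmn hc
  obtain ⟨p, hp, hcp⟩ := mem_sides_succ.mp hc
  obtain rfl := eq_of_mem_halfOpenHull hs hp (halfOpenCell_subset s hz) (hull_child_subset hcp hzc)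
  obtain ⟨x, y, rfl, h0, h1, h2⟩ := hz
  obtain ⟨x', y', hz, h0', h1', h2'⟩ := hzc
  rcases hcp with rfl | rfl | rfl | rfl <;>
  · simp only [pt_child₁, pt_child₂, pt_child₃, pt_child₄] at hz
    obtain ⟨hx, hy⟩ := pt_inj (sides_sub_ne_zero hs) hz
    linarith

lemma notMem_curve_of_mem_openTriangle {n : ℕ} {z : ℂ} (hz : z ∈ openTriangle) : z ∉ curve n := by
  intro hzn
  obtain ⟨c, hc, x', y', hzc, h0', h1', h2'⟩ := exists_mem_hull_of_mem_curve (Nat.zero_le n) hzn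
  obtain ⟨x, y, rfl, h0, h1, h2⟩ := hz
  rcases mem_sides_zero.mp hc with rfl | rfl | rfl <;>
  · try simp only [pt_rightSide, pt_leftSide] at hzc
    obtain ⟨hx, hy⟩ := pt_inj (sides_sub_ne_zero base_mem) hzc
    linarith

lemma eq_of_mem_openSegment {n : ℕ} {s s' : ℂ × ℂ} (hs : s ∈ sides n) (hs' : s' ∈ sides n) {z : ℂ}
    (hz : z ∈ openSegment ℝ s.1 s.2) (hz' : z ∈ openSegment ℝ s'.1 s'.2) : s = s' :=
  eq_of_mem_halfOpenHull hs hs' (openSegment_subset_halfOpenHull s hz)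
    (segment_subset_hull s' (openSegment_subset_segment ℝ _ _ hz'))

lemma convexHull_triple_coord {a b c z : ℂ} (hz : z ∈ convexHull ℝ {a, b, c}) :
    ∃ p q r : ℝ, 0 ≤ p ∧ 0 ≤ q ∧ 0 ≤ r ∧ p + q + r = 1 ∧ z = p * a + q * b + r * c := by
  rw [convexHull_insert (Set.insert_nonempty _ _), convexHull_pair] at hz
  simp only [convexJoin_singleton_left, Set.mem_iUnion] at hz
  obtain ⟨w, ⟨q, r, hq, hr, hqr, rfl⟩, p, t, hp, ht, hpt, rfl⟩ := hz
  refine ⟨p, t * q, t * r, hp, by positivity, by positivity, by nlinarith, ?_⟩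
  simp only [Complex.real_smul]; push_cast; ring

lemma cell_coord {s : ℂ × ℂ} {z : ℂ} (hz : z ∈ cell s) :
    ∃ x y : ℝ, z = pt s x y ∧ 0 ≤ y ∧ 1 / 3 ≤ x ∧ x + y ≤ 2 / 3 := by
  obtain ⟨p, q, r, hp, hq, hr, h1, rfl⟩ := convexHull_triple_coord hz
  refine ⟨1 / 3 + r / 3, q / 3, ?_, by positivity, by linarith, by linarith⟩
  obtain rfl : p = 1 - q - r := by linarith
  simp only [pt, apex_eq, ghostLeft, ghostRight]; push_cast; ring

lemma table_zero_coord {z : ℂ} (hz : z ∈ table 0) :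
    ∃ x y : ℝ, z = pt base x y ∧ y ≤ 0 ∧ x ≤ 1 ∧ 0 ≤ x + y := by
  obtain ⟨p, q, r, hp, hq, hr, h1, rfl⟩ := convexHull_triple_coord hz
  refine ⟨q + r, -r, ?_, by linarith, by linarith, by linarith⟩
  rw [pt_base, dirPiThird_eq_one_sub_eta]; push_cast; ring

/-- A newly glued cell lies in the hull of its own side. Hence only the cell on the parent could
meet the open hull of a child, and coordinates exclude that. -/
lemma notMem_table_of_mem_openHull {n : ℕ} {s : ℂ × ℂ} (hs : s ∈ sides n) {z : ℂ}
    (hz : z ∈ openHull s) : z ∉ table n := by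
  induction n generalizing s with
  | zero =>
    intro ht
    obtain ⟨x', y', hzt, h0', h1', h2'⟩ := table_zero_coord ht
    obtain ⟨x, y, rfl, h0, h1, h2⟩ := hz
    rcases mem_sides_zero.mp hs with rfl | rfl | rfl <;>
    · try simp only [pt_rightSide, pt_leftSide] at hzt
      obtain ⟨hx, hy⟩ := pt_inj (sides_sub_ne_zero base_mem) hzt
      linarith
  | succ n ih =>
    obtain ⟨p, hp, hsp⟩ := mem_sides_succ.mp hs
    have hzp := openHull_child_subset hsp hz
    rintro (ht | ht)
    · exact ih hp hzp ht
    · simp only [Set.mem_iUnion] at ht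
      obtain ⟨q, hq, hzq⟩ := ht
      obtain ⟨x', y', hzt, h0', h1', h2'⟩ := cell_coord hzq
      obtain rfl := eq_of_mem_halfOpenHull hp hq (openHull_subset p hzp)
        ⟨x', y', hzt, h0', by linarith, by linarith⟩
      obtain ⟨x, y, rfl, h0, h1, h2⟩ := hz
      rcases hsp with rfl | rfl | rfl | rfl <;>
      · simp only [pt_child₁, pt_child₂, pt_child₃, pt_child₄] at hzt
        obtain ⟨hx, hy⟩ := pt_inj (sides_sub_ne_zero hp) hzt
        linarith

/-! ### Reflection in a side, in frame coordinates -/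

lemma reflection_mul (D w : ℂ) :
    (Submodule.span ℝ {D}).reflection (D * w) = D * (starRingEnd ℂ) w := by
  have h1 : (w.re : ℂ) * D ∈ Submodule.span ℝ {D} :=
    Submodule.mem_span_singleton.mpr ⟨w.re, by simp⟩
  have h2 : (w.im : ℂ) * Complex.I * D ∈ (Submodule.span ℝ {D})ᗮ := by
    rw [Submodule.mem_orthogonal_singleton_iff_inner_right]
    simp [Complex.inner]; ring
  have e : D * w = (w.re : ℂ) * D + (w.im : ℂ) * Complex.I * D := by
    conv_lhs => rw [← Complex.re_add_im w]
    ring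
  have e' : (starRingEnd ℂ) w = (w.re : ℂ) - (w.im : ℂ) * Complex.I := by
    apply Complex.ext <;> simp
  rw [e, map_add, Submodule.reflection_mem_subspace_eq_self h1,
    Submodule.reflection_mem_subspace_orthogonalComplement_eq_neg h2, e']
  ring

lemma reflection_dir (s : ℂ × ℂ) (m : ℕ) (a b : ℝ) :
    (Submodule.span ℝ {s.2 - s.1}).reflection (dir s m a b) = dir s m (a + b) (-b) := by
  have e : dir s m a b = (s.2 - s.1) * (3 ^ m * (a + b * eta)) := by rw [dir]; ring
  rw [e, reflection_mul, dir]
  simp only [map_mul, map_add, map_pow, Complex.conj_ofReal, conj_eta, map_ofNat]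
  push_cast; ring

/-! ### Ternary digits: return point, excess length and number of reflections -/

/-- `u` lies in the open unit interval and is not a triadic rational. -/
def NonTriadic (u : ℝ) : Prop := 0 < u ∧ u < 1 ∧ ∀ (j : ℕ) (k : ℤ), (3 : ℝ) ^ j * u ≠ k

lemma NonTriadic.one_sub {u : ℝ} (h : NonTriadic u) : NonTriadic (1 - u) := by
  obtain ⟨h0, h1, h2⟩ := h
  refine ⟨by linarith, by linarith, fun j k hk => h2 j (3 ^ j - k) ?_⟩
  push_cast; linarith

lemma NonTriadic.exists_digit {u : ℝ} (h : NonTriadic u) :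
    ∃ v, NonTriadic v ∧ (u = v / 3 ∨ u = (1 + v) / 3 ∨ u = (2 + v) / 3) := by
  obtain ⟨h0, h1, h2⟩ := h
  have key : ∀ d : ℤ, 0 < 3 * u - d → 3 * u - d < 1 → NonTriadic (3 * u - d) := by
    intro d hd0 hd1
    refine ⟨hd0, hd1, fun j k hk => h2 (j + 1) (k + 3 ^ j * d) ?_⟩
    push_cast; rw [← hk]; ring
  have n1 : u ≠ 1 / 3 := fun e => h2 1 1 (by rw [e]; norm_num)
  have n2 : u ≠ 2 / 3 := fun e => h2 1 2 (by rw [e]; norm_num)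
  rcases lt_or_gt_of_ne n1 with a | a
  · exact ⟨_, key 0 (by push_cast; linarith) (by push_cast; linarith), Or.inl (by push_cast; ring)⟩
  rcases lt_or_gt_of_ne n2 with b | b
  · exact ⟨_, key 1 (by push_cast; linarith) (by push_cast; linarith),
      Or.inr (Or.inl (by push_cast; ring))⟩
  · exact ⟨_, key 2 (by push_cast; linarith) (by push_cast; linarith),
      Or.inr (Or.inr (by push_cast; ring))⟩

lemma NonTriadic.cons {v : ℝ} (h : NonTriadic v) {d : ℤ} (h0 : 0 ≤ d) (h2 : d ≤ 2) :
    NonTriadic ((d + v) / 3) := by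
  obtain ⟨hv0, hv1, hv⟩ := h
  have h0' : (0 : ℝ) ≤ d := by exact_mod_cast h0
  have h2' : (d : ℝ) ≤ 2 := by exact_mod_cast h2
  refine ⟨by linarith, by linarith, fun j k hk => ?_⟩
  cases j with
  | zero =>
    refine hv 0 (3 * k - d) ?_
    push_cast; linarith
  | succ j =>
    refine hv j (k - 3 ^ j * d) ?_
    push_cast; rw [← hk]; ring

lemma NonTriadic.cons_zero {v : ℝ} (h : NonTriadic v) : NonTriadic (v / 3) := by
  simpa using h.cons (d := 0) (by norm_num) (by norm_num)

lemma NonTriadic.cons_one {v : ℝ} (h : NonTriadic v) : NonTriadic ((1 + v) / 3) := by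
  simpa using h.cons (d := 1) (by norm_num) (by norm_num)

lemma NonTriadic.cons_two {v : ℝ} (h : NonTriadic v) : NonTriadic ((2 + v) / 3) := by
  simpa using h.cons (d := 2) (by norm_num) (by norm_num)

/-- Reflects the ternary expansion from the first digit `1` on, if there is one among the first `k`
digits. A ball that leaves through a side at the parameter `u` comes back at `mirror k u`, where `k`
is the number of further subdivisions of the side. -/
def mirror : ℕ → ℝ → ℝ
  | 0, u => u
  | k + 1, u => if u < 1 / 3 then mirror k (3 * u) / 3 else
      if u < 2 / 3 then 1 - u else (2 + mirror k (3 * u - 2)) / 3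

/-- The symmetrised length of an excursion through a side of length one. -/
def excess : ℕ → ℝ → ℝ
  | 0, _ => 0
  | k + 1, u => if u < 1 / 3 then excess k (3 * u) / 3 else
      if u < 2 / 3 then 1 + 2 / 3 * excess k (3 * u - 1) else excess k (3 * u - 2) / 3

/-- The number of reflections during an excursion. -/
def bounces : ℕ → ℝ → ℕ
  | 0, _ => 1
  | k + 1, u => if u < 1 / 3 then bounces k (3 * u) else
      if u < 2 / 3 then 2 * bounces k (3 * u - 1) else bounces k (3 * u - 2)

section digits

variable {v : ℝ} (h : NonTriadic v) (k : ℕ)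
include h

lemma mirror_cons_zero : mirror (k + 1) (v / 3) = mirror k v / 3 := by
  have e : 3 * (v / 3) = v := by ring
  rw [mirror, if_pos (by linarith [h.2.1]), e]

lemma mirror_cons_one : mirror (k + 1) ((1 + v) / 3) = (2 - v) / 3 := by
  rw [mirror, if_neg (by linarith [h.1]), if_pos (by linarith [h.2.1])]; ring

lemma mirror_cons_two : mirror (k + 1) ((2 + v) / 3) = (2 + mirror k v) / 3 := by
  have e : 3 * ((2 + v) / 3) - 2 = v := by ring
  rw [mirror, if_neg (by linarith [h.1]), if_neg (by linarith [h.1]), e]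

lemma excess_cons_zero : excess (k + 1) (v / 3) = excess k v / 3 := by
  have e : 3 * (v / 3) = v := by ring
  rw [excess, if_pos (by linarith [h.2.1]), e]

lemma excess_cons_one : excess (k + 1) ((1 + v) / 3) = 1 + 2 / 3 * excess k v := by
  have e : 3 * ((1 + v) / 3) - 1 = v := by ring
  rw [excess, if_neg (by linarith [h.1]), if_pos (by linarith [h.2.1]), e]

lemma excess_cons_two : excess (k + 1) ((2 + v) / 3) = excess k v / 3 := by
  have e : 3 * ((2 + v) / 3) - 2 = v := by ring
  rw [excess, if_neg (by linarith [h.1]), if_neg (by linarith [h.1]), e]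

lemma bounces_cons_zero : bounces (k + 1) (v / 3) = bounces k v := by
  have e : 3 * (v / 3) = v := by ring
  rw [bounces, if_pos (by linarith [h.2.1]), e]

lemma bounces_cons_one : bounces (k + 1) ((1 + v) / 3) = 2 * bounces k v := by
  have e : 3 * ((1 + v) / 3) - 1 = v := by ring
  rw [bounces, if_neg (by linarith [h.1]), if_pos (by linarith [h.2.1]), e]

lemma bounces_cons_two : bounces (k + 1) ((2 + v) / 3) = bounces k v := by
  have e : 3 * ((2 + v) / 3) - 2 = v := by ring
  rw [bounces, if_neg (by linarith [h.1]), if_neg (by linarith [h.1]), e]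

end digits

lemma NonTriadic.mirror {u : ℝ} (h : NonTriadic u) (k : ℕ) : NonTriadic (mirror k u) := by
  induction k generalizing u with
  | zero => exact h
  | succ k ih =>
    obtain ⟨v, hv, rfl | rfl | rfl⟩ := h.exists_digit
    · rw [mirror_cons_zero hv]; exact (ih hv).cons_zero
    · rw [mirror_cons_one hv]
      have := hv.one_sub.cons_one
      rwa [show (1 + (1 - v)) / 3 = (2 - v) / 3 by ring] at this
    · rw [mirror_cons_two hv]; exact (ih hv).cons_two

lemma one_sub_cons (v : ℝ) : 1 - v / 3 = (2 + (1 - v)) / 3 ∧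
    1 - (1 + v) / 3 = (1 + (1 - v)) / 3 ∧ 1 - (2 + v) / 3 = (1 - v) / 3 :=
  ⟨by ring, by ring, by ring⟩

/-- The map `u ↦ 1 - u` exchanges the digits 0 and 2 and fixes 1, and the three recursions treat 0
and 2 alike. -/
lemma one_sub_symmetry {u : ℝ} (h : NonTriadic u) (k : ℕ) :
    mirror k (1 - u) = 1 - mirror k u ∧ excess k (1 - u) = excess k u ∧
      bounces k (1 - u) = bounces k u := by
  induction k generalizing u with
  | zero => simp [mirror, excess, bounces]
  | succ k ih =>
    obtain ⟨v, hv, rfl | rfl | rfl⟩ := h.exists_digit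
    · obtain ⟨h1, h2, h3⟩ := ih hv
      rw [(one_sub_cons v).1, mirror_cons_two hv.one_sub, mirror_cons_zero hv,
        excess_cons_two hv.one_sub, excess_cons_zero hv, bounces_cons_two hv.one_sub,
        bounces_cons_zero hv, h1, h2, h3]
      exact ⟨by ring, rfl, rfl⟩
    · obtain ⟨h1, h2, h3⟩ := ih hv
      rw [(one_sub_cons v).2.1, mirror_cons_one hv.one_sub, mirror_cons_one hv,
        excess_cons_one hv.one_sub, excess_cons_one hv, bounces_cons_one hv.one_sub,
        bounces_cons_one hv, h2, h3]
      exact ⟨by ring, rfl, rfl⟩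
    · obtain ⟨h1, h2, h3⟩ := ih hv
      rw [(one_sub_cons v).2.2, mirror_cons_zero hv.one_sub, mirror_cons_two hv,
        excess_cons_zero hv.one_sub, excess_cons_two hv, bounces_cons_zero hv.one_sub,
        bounces_cons_two hv, h1, h2, h3]
      exact ⟨by ring, rfl, rfl⟩

lemma mirror_one_sub {u : ℝ} (h : NonTriadic u) (k : ℕ) :
    mirror k (1 - u) = 1 - mirror k u := (one_sub_symmetry h k).1

lemma excess_one_sub {u : ℝ} (h : NonTriadic u) (k : ℕ) :
    excess k (1 - u) = excess k u := (one_sub_symmetry h k).2.1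

lemma bounces_one_sub {u : ℝ} (h : NonTriadic u) (k : ℕ) :
    bounces k (1 - u) = bounces k u := (one_sub_symmetry h k).2.2

/-- Leading digits 0 and 2 are kept by `mirror`. At the first digit 1 it acts as `u ↦ 1 - u`, so the
claim reduces to `one_sub_symmetry`. -/
lemma mirror_symmetry {u : ℝ} (h : NonTriadic u) (k : ℕ) :
    mirror k (mirror k u) = u ∧ excess k (mirror k u) = excess k u ∧
      bounces k (mirror k u) = bounces k u := by
  induction k generalizing u with
  | zero => simp [mirror, excess, bounces]
  | succ k ih =>
    obtain ⟨v, hv, rfl | rfl | rfl⟩ := h.exists_digit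
    · obtain ⟨h1, h2, h3⟩ := ih hv
      rw [mirror_cons_zero hv, mirror_cons_zero (hv.mirror k), excess_cons_zero (hv.mirror k),
        bounces_cons_zero (hv.mirror k), excess_cons_zero hv, bounces_cons_zero hv, h1, h2, h3]
      simp
    · have e : mirror (k + 1) ((1 + v) / 3) = 1 - (1 + v) / 3 := by
        rw [mirror_cons_one hv]; ring
      rw [e, mirror_one_sub h, excess_one_sub h, bounces_one_sub h, e]
      simp
    · obtain ⟨h1, h2, h3⟩ := ih hv
      rw [mirror_cons_two hv, mirror_cons_two (hv.mirror k), excess_cons_two (hv.mirror k),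
        bounces_cons_two (hv.mirror k), excess_cons_two hv, bounces_cons_two hv, h1, h2, h3]
      simp

lemma mirror_mirror {u : ℝ} (h : NonTriadic u) (k : ℕ) : mirror k (mirror k u) = u :=
  (mirror_symmetry h k).1

lemma excess_mirror {u : ℝ} (h : NonTriadic u) (k : ℕ) : excess k (mirror k u) = excess k u :=
  (mirror_symmetry h k).2.1

lemma bounces_mirror {u : ℝ} (h : NonTriadic u) (k : ℕ) : bounces k (mirror k u) = bounces k u :=
  (mirror_symmetry h k).2.2

lemma bounces_pos (k : ℕ) (u : ℝ) : 0 < bounces k u := by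
  induction k generalizing u with
  | zero => simp [bounces]
  | succ k ih =>
    rw [bounces]
    split_ifs
    · exact ih _
    · exact Nat.mul_pos two_pos (ih _)
    · exact ih _

lemma excess_nonneg (k : ℕ) (u : ℝ) : 0 ≤ excess k u := by
  induction k generalizing u with
  | zero => simp [excess]
  | succ k ih =>
    rw [excess]
    split_ifs
    · linarith [ih (3 * u)]
    · linarith [ih (3 * u - 1)]
    · linarith [ih (3 * u - 2)]

/-- The constant 3 is the fixed point of `e ↦ 1 + 2 / 3 * e`, the recursion at the digit 1. -/
lemma excess_le (k : ℕ) (u : ℝ) : excess k u ≤ 3 := by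
  induction k generalizing u with
  | zero => simp [excess]
  | succ k ih =>
    rw [excess]
    split_ifs
    · linarith [ih (3 * u)]
    · linarith [ih (3 * u - 1)]
    · linarith [ih (3 * u - 2)]

lemma excess_le_succ (k : ℕ) (u : ℝ) : excess k u ≤ excess (k + 1) u := by
  induction k generalizing u with
  | zero => exact excess_nonneg 1 u
  | succ k ih =>
    rw [excess, excess]
    split_ifs
    · linarith [ih (3 * u)]
    · linarith [ih (3 * u - 1)]
    · linarith [ih (3 * u - 2)]

/-- After `m` digits the remainder is 1/2, whose digits are all 1, and each of the next `k` digits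
doubles the count. -/
lemma two_pow_le_bounces {m : ℕ} {u : ℝ} (h : NonTriadic u) {a : ℤ}
    (ha : (3 : ℝ) ^ m * u = a + 1 / 2) (k : ℕ) : 2 ^ k ≤ bounces (m + k) u := by
  induction m generalizing u a with
  | zero =>
    have hu : u = 1 / 2 := by
      have h1 := h.1
      have h2 := h.2.1
      rw [pow_zero, one_mul] at ha
      have h3 : a < 1 := by
        have : (a : ℝ) < 1 := by linarith
        exact_mod_cast this
      have h4 : -1 < a := by
        have : (-1 : ℝ) < a := by linarith
        exact_mod_cast this
      obtain rfl : a = 0 := by omega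
      simpa using ha
    subst hu
    rw [zero_add]
    clear ha
    induction k with
    | zero => simp [bounces]
    | succ k ih =>
      have := bounces_cons_one h k
      rw [show (1 + 1 / 2) / 3 = (1 / 2 : ℝ) by norm_num] at this
      rw [this, pow_succ]; omega
  | succ m ih =>
    have e : m + 1 + k = m + k + 1 := by ring
    rw [e]
    obtain ⟨v, hv, rfl | rfl | rfl⟩ := h.exists_digit
    · rw [bounces_cons_zero hv]
      exact ih (a := a) hv (by rw [← ha]; ring)
    · rw [bounces_cons_one hv]
      have := ih (a := a - 3 ^ m) hv (by push_cast; rw [pow_succ] at ha; linarith)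
      omega
    · rw [bounces_cons_two hv]
      exact ih (a := a - 2 * 3 ^ m) hv (by push_cast; rw [pow_succ] at ha; linarith)

/-- A parity obstruction: clearing denominators would equate an even integer with an odd one. -/
lemma nonTriadic_of_half {m : ℕ} {u : ℝ} (h0 : 0 < u) (h1 : u < 1) {a : ℤ}
    (ha : (3 : ℝ) ^ m * u = a + 1 / 2) : NonTriadic u := by
  refine ⟨h0, h1, fun j k hk => ?_⟩
  have h : 2 * (3 : ℝ) ^ m * k = 3 ^ j * (2 * a + 1) := by
    rw [← hk]; linear_combination 2 * (3 : ℝ) ^ j * ha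
  have h' : 2 * (3 : ℤ) ^ m * k = 3 ^ j * (2 * a + 1) := by exact_mod_cast h
  have o : Odd ((3 : ℤ) ^ j * (2 * a + 1)) := (Odd.pow (by decide)).mul (odd_two_mul_add_one a)
  rw [← h', mul_assoc] at o
  exact (Int.not_even_iff_odd.mpr o) (even_two_mul _)

/-! ### Determinism of the billiard and composition of flights -/

lemma IsOrbit.norm_dir {n : ℕ} {z : ℕ → ℂ × ℂ} (hz : IsOrbit n z) (j : ℕ) : ‖(z j).2‖ = 1 := by
  induction j with
  | zero => exact hz.unit
  | succ j ih =>
    obtain ⟨-, s, -, -, h⟩ := hz.step j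
    rw [h, LinearIsometryEquiv.norm_map, ih]

lemma IsOrbit.mem_openSegment {n : ℕ} {z : ℕ → ℂ × ℂ} (hz : IsOrbit n z) (j : ℕ) :
    ∃ s ∈ sides n, (z j).1 ∈ openSegment ℝ s.1 s.2 := by
  cases j with
  | zero => exact hz.start_mem
  | succ j =>
    obtain ⟨-, s, hs, h, -⟩ := hz.step j
    exact ⟨s, hs, h⟩

lemma IsOrbit.mem_curve {n : ℕ} {z : ℕ → ℂ × ℂ} (hz : IsOrbit n z) (j : ℕ) :
    (z j).1 ∈ curve n := by
  obtain ⟨s, hs, h⟩ := hz.mem_openSegment j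
  exact mem_curve_of_mem_openSegment hs h

/-- The first collision on a ray, if it happens inside a side, determines the billiard step. -/
lemma BilliardStep.eq_of_hit {n : ℕ} {p q : ℂ × ℂ} (h : BilliardStep n p q) {s : ℂ × ℂ}
    (hs : s ∈ sides n) {τ : ℝ} (hτ : 0 < τ) (hmem : p.1 + (τ : ℂ) * p.2 ∈ openSegment ℝ s.1 s.2)
    (hfree : ∀ r ∈ Set.Ioo 0 τ, p.1 + (r : ℂ) * p.2 ∉ curve n) :
    q = (p.1 + (τ : ℂ) * p.2, (Submodule.span ℝ {s.2 - s.1}).reflection p.2) := by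
  obtain ⟨⟨t, ht, hq, hfree'⟩, s', hs', hmem', href⟩ := h
  have e : t = τ := by
    rcases lt_trichotomy t τ with h | h | h
    · exact absurd (hq ▸ mem_curve_of_mem_openSegment hs' hmem') (hfree t ⟨ht, h⟩)
    · exact h
    · exact absurd (mem_curve_of_mem_openSegment hs hmem) (hfree' τ ⟨hτ, h⟩).2
  subst e
  rw [← hq] at hmem ⊢
  obtain rfl := eq_of_mem_openSegment hs hs' hmem hmem'
  exact Prod.ext rfl href

lemma BilliardStep.unique {n : ℕ} {p q q' : ℂ × ℂ} (h : BilliardStep n p q)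
    (h' : BilliardStep n p q') : q = q' := by
  obtain ⟨⟨t, ht, hq, hfree⟩, s, hs, hmem, -⟩ := id h
  rw [hq] at hmem
  rw [h.eq_of_hit hs ht hmem fun r hr => (hfree r hr).2,
    h'.eq_of_hit hs ht hmem fun r hr => (hfree r hr).2]

/-- The `j`-th flight of `z` reaches `q` in the direction `d` after time `τ`, unobstructed before. -/
structure Arrives (n : ℕ) (z : ℕ → ℂ × ℂ) (j : ℕ) (τ : ℝ) (q d : ℂ) : Prop where
  pos : 0 < τ
  dir_eq : (z j).2 = d
  eq : (z j).1 + (τ : ℂ) * d = q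
  free : ∀ r ∈ Set.Ioo 0 τ, (z j).1 + (r : ℂ) * d ∉ curve n

/-- The `j`-th flight of `z` starts at `q` or passes through `q` at time `τ`, in the direction
`d`. -/
structure Leaves (n : ℕ) (z : ℕ → ℂ × ℂ) (j : ℕ) (τ : ℝ) (q d : ℂ) : Prop where
  nonneg : 0 ≤ τ
  dir_eq : (z j).2 = d
  eq : (z j).1 + (τ : ℂ) * d = q
  free : ∀ r ∈ Set.Ioc 0 τ, (z j).1 + (r : ℂ) * d ∉ curve n

lemma Leaves.arrives {n : ℕ} {z : ℕ → ℂ × ℂ} {j : ℕ} {τ δ : ℝ} {q q' d : ℂ}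
    (h : Leaves n z j τ q d) (hδ : 0 < δ) (hq : q + (δ : ℂ) * d = q')
    (hfree : ∀ r ∈ Set.Ioo 0 δ, q + (r : ℂ) * d ∉ curve n) : Arrives n z j (τ + δ) q' d := by
  obtain ⟨h0, h1, h2, h3⟩ := h
  refine ⟨by linarith, h1, by rw [← hq, ← h2]; push_cast; ring, fun r hr => ?_⟩
  rcases le_or_gt r τ with hle | hlt
  · exact h3 r ⟨hr.1, hle⟩
  · have := hfree (r - τ) ⟨by linarith, by linarith [hr.2]⟩
    rwa [← h2, show (z j).1 + (τ : ℂ) * d + ((r - τ : ℝ) : ℂ) * d = (z j).1 + (r : ℂ) * d by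
      push_cast; ring] at this

lemma Arrives.leaves {n : ℕ} {z : ℕ → ℂ × ℂ} {j : ℕ} {τ : ℝ} {q d : ℂ}
    (h : Arrives n z j τ q d) (hq : q ∉ curve n) : Leaves n z j τ q d := by
  refine ⟨h.pos.le, h.dir_eq, h.eq, fun r hr => ?_⟩
  rcases hr.2.lt_or_eq with hlt | rfl
  · exact h.free r ⟨hr.1, hlt⟩
  · rwa [h.eq]

/-- Two flights through the same point in the same direction are the same flight. -/
lemma Leaves.eq_of_mem_curve {n : ℕ} {z : ℕ → ℂ × ℂ} {i j : ℕ} {τ τ' : ℝ} {q d : ℂ}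
    (h : Leaves n z i τ q d) (h' : Leaves n z j τ' q d) (hi : (z i).1 ∈ curve n)
    (hj : (z j).1 ∈ curve n) : τ = τ' ∧ z i = z j := by
  have key : ∀ {i j : ℕ} {τ τ' : ℝ}, Leaves n z i τ q d → Leaves n z j τ' q d →
      (z i).1 ∈ curve n → ¬ τ < τ' := by
    intro i j τ τ' h h' hi hlt
    refine h'.free (τ' - τ) ⟨by linarith, by linarith [h.nonneg]⟩ ?_
    have e : (z j).1 + ((τ' - τ : ℝ) : ℂ) * d = (z i).1 := by
      push_cast; linear_combination h'.eq - h.eq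
    rwa [e]
  have e : τ = τ' := le_antisymm (not_lt.mp (key h' h hj)) (not_lt.mp (key h h' hi))
  subst e
  refine ⟨rfl, Prod.ext ?_ (by rw [h.dir_eq, h'.dir_eq])⟩
  exact add_right_cancel (h.eq.trans h'.eq.symm)

/-- The length of `N` successive flights of `z`, beginning with the `j`-th one. -/
def flightLength (z : ℕ → ℂ × ℂ) (j N : ℕ) : ℝ :=
  ∑ i ∈ Finset.range N, dist (z (j + i)).1 (z (j + i + 1)).1

lemma flightLength_add (z : ℕ → ℂ × ℂ) (j N N' : ℕ) :
    flightLength z j (N + N') = flightLength z j N + flightLength z (j + N) N' := by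
  simp only [flightLength, Finset.sum_range_add, add_assoc]

/-- Every flight of `z` that arrives at `q` in the direction `d` continues with `N` reflections at
points of `S`, after which it leaves `q'` in the direction `d'`; the path from `q` to `q'` has
length `L`. -/
def Transit (n : ℕ) (z : ℕ → ℂ × ℂ) (S : Set ℂ) (q d q' d' : ℂ) (N : ℕ) (L : ℝ) : Prop :=
  ∀ j τ, Arrives n z j τ q d → ∃ τ', Leaves n z (j + N) τ' q' d' ∧
    (∀ i, 1 ≤ i → i ≤ N → (z (j + i)).1 ∈ S) ∧ flightLength z j N = τ + L - τ'

section transit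

variable {n : ℕ} {z : ℕ → ℂ × ℂ} {S S' : Set ℂ} {q d q' d' q₂ q₃ d₃ : ℂ} {N N' : ℕ} {L L' δ : ℝ}

lemma Transit.mono (h : Transit n z S q d q' d' N L) (hS : S ⊆ S') :
    Transit n z S' q d q' d' N L := by
  intro j τ ha
  obtain ⟨τ', h1, h2, h3⟩ := h j τ ha
  exact ⟨τ', h1, fun i hi hi' => hS (h2 i hi hi'), h3⟩

lemma Transit.precomp (h : Transit n z S q₂ d q' d' N L) (hδ : 0 < δ) (hq : q + (δ : ℂ) * d = q₂)
    (hfree : ∀ r ∈ Set.Ico 0 δ, q + (r : ℂ) * d ∉ curve n) :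
    Transit n z S q d q' d' N (δ + L) := by
  intro j τ ha
  have hl := ha.leaves (by simpa using hfree 0 ⟨le_rfl, hδ⟩)
  obtain ⟨τ', h1, h2, h3⟩ := h j _ (hl.arrives hδ hq fun r hr => hfree r ⟨hr.1.le, hr.2⟩)
  exact ⟨τ', h1, h2, by rw [h3]; ring⟩

lemma Transit.postcomp (h : Transit n z S q d q' d' N L) (hδ : 0 < δ)
    (hq : q' + (δ : ℂ) * d' = q₂) (hfree : ∀ r ∈ Set.Ioc 0 δ, q' + (r : ℂ) * d' ∉ curve n) :
    Transit n z S q d q₂ d' N (L + δ) := by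
  intro j τ ha
  obtain ⟨τ', h1, h2, h3⟩ := h j τ ha
  have hl := h1.arrives hδ hq fun r hr => hfree r ⟨hr.1, hr.2.le⟩
  exact ⟨τ' + δ, hl.leaves (by rw [← hq]; exact hfree δ ⟨hδ, le_rfl⟩), h2, by rw [h3]; ring⟩

/-- The gap is only required to be free strictly between its ends: `q'` may be a basepoint and `q₂`
the next collision. The flight times cancel, so the lengths add. -/
lemma Transit.comp (h : Transit n z S q d q' d' N L) (h' : Transit n z S q₂ d' q₃ d₃ N' L')
    (hδ : 0 < δ) (hq : q' + (δ : ℂ) * d' = q₂)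
    (hfree : ∀ r ∈ Set.Ioo 0 δ, q' + (r : ℂ) * d' ∉ curve n) :
    Transit n z S q d q₃ d₃ (N + N') (L + δ + L') := by
  intro j τ ha
  obtain ⟨τ', h1, h2, h3⟩ := h j τ ha
  obtain ⟨τ'', h4, h5, h6⟩ := h' _ _ (h1.arrives hδ hq hfree)
  refine ⟨τ'', by rwa [← add_assoc], fun i hi hi' => ?_, ?_⟩
  · rcases le_or_gt i N with hle | hlt
    · exact h2 i hi hle
    · have := h5 (i - N) (by omega) (by omega)
      rwa [show j + N + (i - N) = j + i by omega] at this
  · rw [flightLength_add, h3, h6]; ring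

end transit

/-- Straight motion inside the cell glued to `s`. -/
lemma notMem_curve_of_segment {m n : ℕ} (hmn : m + 1 ≤ n) {s : ℂ × ℂ} (hs : s ∈ sides m)
    {x y a b r : ℝ} (h0 : 0 ≤ y + 3 ^ m * r * b) (h1 : 1 / 3 < x + 3 ^ m * r * a)
    (h2 : x + 3 ^ m * r * a + (y + 3 ^ m * r * b) < 2 / 3) :
    pt s x y + (r : ℂ) * dir s m a b ∉ curve n := by
  refine notMem_curve_of_mem_halfOpenCell hmn hs ⟨_, _, pt_add_dir s m x y a b r, h0, h1, h2⟩

/-- The degenerate excursion: one reflection at the point itself, with no path length and with the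
new flight starting there at time 0. -/
lemma transit_of_hit {n : ℕ} {z : ℕ → ℂ × ℂ} (hz : IsOrbit n z) {s : ℂ × ℂ} (hs : s ∈ sides n)
    {u : ℝ} (hu : NonTriadic u) (a b : ℝ) :
    Transit n z (hull s) (pt s u 0) (dir s n a b) (pt s u 0) (dir s n (a + b) (-b)) 1 0 := by
  intro j τ ha
  have hmem : (z j).1 + (τ : ℂ) * (z j).2 ∈ openSegment ℝ s.1 s.2 := by
    rw [ha.dir_eq, ha.eq]
    exact mem_openSegment_iff.mpr ⟨u, hu.1, hu.2.1, rfl⟩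
  have e := (hz.step j).eq_of_hit hs ha.pos hmem (by rw [ha.dir_eq]; exact ha.free)
  rw [ha.dir_eq, ha.eq, reflection_dir] at e
  refine ⟨0, ⟨le_rfl, by rw [e], by rw [e]; simp, fun r hr => ?_⟩, fun i hi hi' => ?_, ?_⟩
  · exact absurd hr.1 (not_lt.mpr hr.2)
  · obtain rfl : i = 1 := by omega
    rw [e]
    exact ⟨u, 0, rfl, le_rfl, hu.1.le, by linarith [hu.2.1]⟩
  · have hd : ‖dir s n a b‖ = 1 := by rw [← ha.dir_eq, hz.norm_dir]
    simp [flightLength, e, ← ha.eq, hd, abs_of_pos ha.pos]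

/-! ### Excursions through a side and turns around the triangle -/

/-- An excursion through the side `s` of `KS_m` in the table `Ω(KS_n)`, for the two possible
directions of incidence. -/
lemma transit_side {n : ℕ} {z : ℕ → ℂ × ℂ} (hz : IsOrbit n z) (k : ℕ) {m : ℕ} (hn : m + k = n)
    {s : ℂ × ℂ} (hs : s ∈ sides m) {u : ℝ} (hu : NonTriadic u) :
    Transit n z (hull s) (pt s u 0) (dir s m 0 1) (pt s (mirror k u) 0) (dir s m 1 (-1))
      (bounces k u) ((excess k u + (mirror k u - u)) / 2 / 3 ^ m) ∧
    Transit n z (hull s) (pt s u 0) (dir s m (-1) 1) (pt s (mirror k u) 0) (dir s m 0 (-1))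
      (bounces k u) ((excess k u - (mirror k u - u)) / 2 / 3 ^ m) := by
  induction k generalizing m s u with
  | zero =>
    obtain rfl : m = n := by omega
    have h1 := transit_of_hit hz hs hu 0 1
    have h2 := transit_of_hit hz hs hu (-1) 1
    norm_num at h1 h2
    simpa [mirror, bounces, excess] using ⟨h1, h2⟩
  | succ k ih =>
    have hn' : m + 1 + k = n := by omega
    have hm : m + 1 ≤ n := by omega
    have h3 : (3 : ℝ) ^ m ≠ 0 := by positivity
    have h3' : (0 : ℝ) < 3 ^ m := by positivity
    obtain ⟨v, hv, rfl | rfl | rfl⟩ := hu.exists_digit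
    · obtain ⟨hA, hB⟩ := ih hn' (child₁_mem hs) hv
      have hsub : hull (child₁ s) ⊆ hull s := hull_child_subset (Or.inl rfl)
      simp only [dir_child₁, pt_child₁, zero_div] at hA hB
      rw [mirror_cons_zero hv, excess_cons_zero hv, bounces_cons_zero hv]
      constructor
      · convert hA.mono hsub using 1
        rw [pow_succ]; field_simp
      · convert hB.mono hsub using 1
        rw [pow_succ]; field_simp
    -- Digit 1: the ball crosses the ghost. The first free side of the cell is met at its parameter
    -- `v` and left at `mirror k v`, the second is met at `1 - mirror k v` and left at `1 - v`.
    · have hw := (hv.mirror k).one_sub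
      obtain ⟨hA₂, hB₂⟩ := ih hn' (child₂_mem hs) hv
      obtain ⟨hA₃, hB₃⟩ := ih hn' (child₃_mem hs) hv
      obtain ⟨hA₂', hB₂'⟩ := ih hn' (child₂_mem hs) hw
      obtain ⟨hA₃', hB₃'⟩ := ih hn' (child₃_mem hs) hw
      have hsub₂ : hull (child₂ s) ⊆ hull s := hull_child_subset (Or.inr (Or.inl rfl))
      have hsub₃ : hull (child₃ s) ⊆ hull s := hull_child_subset (Or.inr (Or.inr (Or.inl rfl)))
      simp only [dir_child₂, pt_child₂, dir_child₃, pt_child₃] at hA₂ hB₂ hA₃ hB₃ hA₂' hB₂' hA₃' hB₃'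
      norm_num at hA₂ hB₂ hA₃ hB₃ hA₂' hB₂' hA₃' hB₃'
      simp only [mirror_one_sub (hv.mirror k), mirror_mirror hv, excess_one_sub (hv.mirror k),
        excess_mirror hv, bounces_one_sub (hv.mirror k), bounces_mirror hv] at hA₂' hB₂' hA₃' hB₃'
      rw [mirror_cons_one hv, excess_cons_one hv, bounces_cons_one hv, two_mul]
      obtain ⟨hv0, hv1, -⟩ := hv
      obtain ⟨hf0, hf1, -⟩ := hw
      have pos : ∀ {c : ℝ}, 0 < c → 0 < c / 3 / 3 ^ m := fun hc => by positivity
      have mul_pos' : ∀ {r : ℝ}, 0 < r → 0 < 3 ^ m * r := fun hr => by positivity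
      have lt : ∀ {c r : ℝ}, r < c / 3 / 3 ^ m → 3 ^ m * r < c / 3 := fun hr => by
        rw [mul_comm]; exact (lt_div_iff₀ h3').mp hr
      have le : ∀ {c r : ℝ}, r ≤ c / 3 / 3 ^ m → 3 ^ m * r ≤ c / 3 := fun hr => by
        rw [mul_comm]; exact (le_div_iff₀ h3').mp hr
      constructor
      -- The direction `(0, 1)` is parallel to `child₂ s`, so `child₃ s` is met first. Between the
      -- two free sides the ball moves parallel to `s`.
      · have t₁ := (hB₃.mono hsub₃).precomp (q := pt s ((1 + v) / 3) 0)
          (pos (c := 1 - v) (by linarith))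
          (by rw [pt_add_dir]; congr 1 <;> field_simp <;> ring)
          (fun r hr => by
            have := lt hr.2
            have : 0 ≤ 3 ^ m * r := mul_nonneg h3'.le hr.1
            apply notMem_curve_of_segment hm hs <;> linarith)
        have t₂ := t₁.comp (hB₂'.mono hsub₂) (pos (c := mirror k v) (by linarith))
          (by rw [pt_add_dir]; congr 1 <;> field_simp <;> ring)
          (fun r hr => by
            have := lt hr.2
            have := mul_pos' hr.1
            apply notMem_curve_of_segment hm hs <;> linarith)
        have t₃ := t₂.postcomp (q₂ := pt s ((2 - v) / 3) 0) (pos (c := 1 - v) (by linarith))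
          (by rw [pt_add_dir]; congr 1 <;> field_simp <;> ring)
          (fun r hr => by
            have := le hr.2
            have := mul_pos' hr.1
            apply notMem_curve_of_segment hm hs <;> linarith)
        convert t₃ using 1
        rw [pow_succ]; field_simp; ring
      -- The direction `(-1, 1)` is parallel to `child₃ s`, so the order is reversed.
      · have t₁ := (hA₂.mono hsub₂).precomp (q := pt s ((1 + v) / 3) 0) (pos hv0)
          (by rw [pt_add_dir]; congr 1 <;> field_simp <;> ring)
          (fun r hr => by
            have := lt hr.2
            have : 0 ≤ 3 ^ m * r := mul_nonneg h3'.le hr.1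
            apply notMem_curve_of_segment hm hs <;> linarith)
        have t₂ := t₁.comp (hA₃'.mono hsub₃) (pos hf0)
          (by rw [pt_add_dir]; congr 1 <;> field_simp; ring)
          (fun r hr => by
            have := lt hr.2
            have := mul_pos' hr.1
            apply notMem_curve_of_segment hm hs <;> linarith)
        have t₃ := t₂.postcomp (q₂ := pt s ((2 - v) / 3) 0) (pos hv0)
          (by rw [pt_add_dir]; congr 1 <;> field_simp <;> ring)
          (fun r hr => by
            have := le hr.2
            have := mul_pos' hr.1
            apply notMem_curve_of_segment hm hs <;> linarith)
        convert t₃ using 1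
        rw [pow_succ]; field_simp; ring
    · obtain ⟨hA, hB⟩ := ih hn' (child₄_mem hs) hv
      have hsub : hull (child₄ s) ⊆ hull s :=
        hull_child_subset (Or.inr (Or.inr (Or.inr rfl)))
      simp only [dir_child₄, pt_child₄, zero_div] at hA hB
      rw [mirror_cons_two hv, excess_cons_two hv, bounces_cons_two hv]
      constructor
      · convert hA.mono hsub using 1
        rw [pow_succ]; field_simp; ring
      · convert hB.mono hsub using 1
        rw [pow_succ]; field_simp; ring

lemma notMem_curve_of_segment_openTriangle {n : ℕ} {x y a b r : ℝ} (h0 : y + r * b < 0)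
    (h1 : x + r * a < 1) (h2 : 0 < x + r * a + (y + r * b)) :
    pt base x y + (r : ℂ) * dir base 0 a b ∉ curve n := by
  refine notMem_curve_of_mem_openTriangle ⟨x + r * a, y + r * b, ?_, h0, h1, h2⟩
  rw [pt_add_dir]; simp

/-- One turn around the initial triangle: a ball that enters it through the base at the parameter
`x` in the direction `π/3` makes one excursion through each side and enters it again at the
parameter `1 - mirror n x` in the same direction. -/
lemma round {n : ℕ} {z : ℕ → ℂ × ℂ} (hz : IsOrbit n z) {x : ℝ} (hx : NonTriadic x) {j : ℕ} {τ : ℝ}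
    (h : Leaves n z j τ (pt base x 0) (dir base 0 1 (-1))) :
    ∃ τ', Leaves n z (j + 3 * bounces n x) τ' (pt base (1 - mirror n x) 0) (dir base 0 1 (-1)) ∧
      (∀ i, 1 ≤ i → i ≤ bounces n x → (z (j + i)).1 ∈ hull rightSide) ∧
      (∀ i, bounces n x < i → i ≤ 2 * bounces n x → (z (j + i)).1 ∈ hull leftSide) ∧
      (∀ i, 2 * bounces n x < i → i ≤ 3 * bounces n x → (z (j + i)).1 ∈ hull base) ∧
      flightLength z j (3 * bounces n x) =
        τ + (2 + 3 / 2 * excess n x - x / 2 - mirror n x / 2) - τ' := by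
  have hf := hx.mirror n
  -- The parameters met are `1 - x` on the right side, `mirror n x` on the left side and `1 - x` on
  -- the base. Each exit parameter is the `mirror` of the entry, and crossing the triangle turns a
  -- parameter `u` into `1 - u`.
  have tR := (transit_side hz n (zero_add n) rightSide_mem hx.one_sub).1
  have tL := (transit_side hz n (zero_add n) leftSide_mem hf).1
  have tB := (transit_side hz n (zero_add n) base_mem hx.one_sub).1
  simp only [pt_rightSide, dir_rightSide, pt_leftSide, dir_leftSide, mirror_one_sub hx,
    mirror_mirror hx, bounces_one_sub hx, bounces_mirror hx, excess_one_sub hx,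
    excess_mirror hx] at tR tL tB
  norm_num at tR tL tB
  have hx0 := hx.1
  have hx1 := hx.2.1
  have hf0 := hf.1
  have hf1 := hf.2.1
  have a₁ := h.arrives (q' := pt base 1 (x - 1)) (δ := 1 - x) (by linarith)
    (by rw [pt_add_dir]; congr 1 <;> simp)
    (fun r hr => by
      have := hr.1
      have := hr.2
      apply notMem_curve_of_segment_openTriangle <;> linarith)
  obtain ⟨τ₁, l₁, m₁, e₁⟩ := tR _ _ a₁
  have a₂ := l₁.arrives (q' := pt base (1 - mirror n x) (mirror n x - 1)) hf0
    (by rw [pt_add_dir]; congr 1 <;> simp; ring)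
    (fun r hr => by
      have := hr.1
      have := hr.2
      apply notMem_curve_of_segment_openTriangle <;> linarith)
  obtain ⟨τ₂, l₂, m₂, e₂⟩ := tL _ _ a₂
  have a₃ := l₂.arrives (q' := pt base (1 - x) 0) (δ := 1 - x) (by linarith)
    (by rw [pt_add_dir]; congr 1 <;> simp)
    (fun r hr => by
      have := hr.1
      have := hr.2
      apply notMem_curve_of_segment_openTriangle <;> linarith)
  obtain ⟨τ₃, l₃, m₃, e₃⟩ := tB _ _ a₃
  have e : 3 * bounces n x = bounces n x + bounces n x + bounces n x := by ring
  refine ⟨τ₃, by rwa [e, ← add_assoc, ← add_assoc], m₁, fun i hi hi' => ?_, fun i hi hi' => ?_, ?_⟩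
  · have := m₂ (i - bounces n x) (by omega) (by omega)
    rwa [show j + bounces n x + (i - bounces n x) = j + i by omega] at this
  · have := m₃ (i - 2 * bounces n x) (by omega) (by omega)
    rwa [show j + bounces n x + bounces n x + (i - 2 * bounces n x) = j + i by omega] at this
  · rw [e, flightLength_add, flightLength_add, e₁, e₂, ← add_assoc, e₃]; ring

/-- The three initial hulls may share vertices, but a basepoint is interior to a side and hence lies
in exactly one half-open hull. -/
lemma eq_of_mem_hull {n : ℕ} {z : ℕ → ℂ × ℂ} (hz : IsOrbit n z) (j : ℕ) {s s' : ℂ × ℂ}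
    (hs : s ∈ sides 0) (hs' : s' ∈ sides 0) (h : (z j).1 ∈ hull s) (h' : (z j).1 ∈ hull s') :
    s = s' := by
  obtain ⟨t, ht, hm⟩ := hz.mem_openSegment j
  obtain ⟨t₀, ht₀, hm₀⟩ : ∃ t₀ ∈ sides 0, halfOpenHull t ⊆ halfOpenHull t₀ := by
    clear hm
    clear * - ht
    induction n generalizing t with
    | zero => exact ⟨t, ht, subset_rfl⟩
    | succ n ih =>
      obtain ⟨p, hp, hc⟩ := mem_sides_succ.mp ht
      obtain ⟨t₀, ht₀, h⟩ := ih p hp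
      exact ⟨t₀, ht₀, (halfOpenHull_child_subset hc).trans h⟩
  have hm' := hm₀ (openSegment_subset_halfOpenHull t hm)
  rw [← eq_of_mem_halfOpenHull ht₀ hs hm' h, ← eq_of_mem_halfOpenHull ht₀ hs' hm' h']

lemma base_ne_rightSide : base ≠ rightSide := by simp [base, rightSide]

lemma Leaves.coord {n : ℕ} {z : ℕ → ℂ × ℂ} {j : ℕ} {τ x : ℝ}
    (h : Leaves n z j τ (pt base x 0) (dir base 0 1 (-1))) : (z j).1 = pt base (x - τ) τ := by
  have := h.eq
  rw [pt_base, dir_base] at this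
  rw [pt_base]
  push_cast at *
  linear_combination this

/-- The initial state does not recur before the end of a turn. -/
lemma ne_of_round {n : ℕ} {z : ℕ → ℂ × ℂ} (hz : IsOrbit n z) {x x' : ℝ} (hx : NonTriadic x)
    (hx' : NonTriadic x') {j : ℕ} {τ τ' : ℝ}
    (h : Leaves n z 0 τ (pt base x 0) (dir base 0 1 (-1)))
    (h' : Leaves n z j τ' (pt base x' 0) (dir base 0 1 (-1))) {i : ℕ} (hi : 0 < i)
    (hi' : i < 3 * bounces n x') : z (j + i) ≠ z 0 := by
  intro e
  obtain ⟨_, -, hR, -, -, -⟩ := round hz hx h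
  obtain ⟨_, -, hR', hL', hB', -⟩ := round hz hx' h'
  have hτ := h.nonneg
  have hs0 := sides_sub_ne_zero base_mem
  rcases le_or_gt i (bounces n x') with h1 | h1
  · obtain ⟨a, b, hab, h0, h1, h2⟩ := hR' i hi h1
    rw [e, h.coord, pt_rightSide] at hab
    obtain ⟨e1, e2⟩ := pt_inj hs0 hab
    linarith [hx.2.1]
  rcases le_or_gt i (2 * bounces n x') with h2 | h2
  · obtain ⟨a, b, hab, h0, h1, h2⟩ := hL' i h1 h2
    rw [e, h.coord, pt_leftSide] at hab
    obtain ⟨e1, e2⟩ := pt_inj hs0 hab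
    linarith [hx.1]
  -- During the excursion through the base the starting hull gives no contradiction, so the next
  -- basepoint is compared: it is still in the hull of the base, whereas `z 1` is in the hull of the
  -- right side.
  · have e1 : z (j + (i + 1)) = z 1 := by
      have h3 := hz.step (j + i)
      rw [e] at h3
      exact h3.unique (hz.step 0)
    have hb := hB' (i + 1) (by omega) (by omega)
    have hr := hR 1 le_rfl (bounces_pos n x)
    rw [e1] at hb
    rw [zero_add] at hr
    exact base_ne_rightSide (eq_of_mem_hull hz 1 base_mem rightSide_mem hb hr)

/-! ### Period and length of an orbit -/

lemma period_eq {z : ℕ → ℂ × ℂ} {N : ℕ} (hN : 0 < N) (h : z N = z 0)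
    (hmin : ∀ j, 0 < j → j < N → z j ≠ z 0) : period z = N := by
  refine le_antisymm (Nat.sInf_le ⟨hN, h⟩) ?_
  by_contra! hlt
  obtain ⟨h0, h1⟩ := Nat.sInf_mem (s := {p | 0 < p ∧ z p = z 0}) ⟨N, hN, h⟩
  exact hmin _ h0 hlt h1

lemma pathLength_eq (z : ℕ → ℂ × ℂ) : pathLength z = flightLength z 0 (period z) := by
  simp [pathLength, flightLength]

/-- The length of the orbit of `Ω(KS_n)` through the point `x` of the base in the direction
`π/3`. -/
def orbitLength (n : ℕ) (x : ℝ) : ℝ :=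
  if mirror n x = 1 - x then (3 + 3 * excess n x) / 2 else 3 + 3 * excess n x

/-- The foot map `x ↦ 1 - mirror n x` is an involution, so the orbit closes after one turn when `x`
is fixed and after two otherwise. Over two turns the terms in `x` and `mirror n x` cancel from the
length. -/
lemma pathLength_period {n : ℕ} {z : ℕ → ℂ × ℂ} (hz : IsOrbit n z) {x τ : ℝ} (hx : NonTriadic x)
    (h : Leaves n z 0 τ (pt base x 0) (dir base 0 1 (-1))) :
    pathLength z = orbitLength n x ∧ 3 * bounces n x ≤ period z := by
  have hN := bounces_pos n x
  obtain ⟨τ₁, l₁, -, -, -, e₁⟩ := round hz hx h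
  rw [pathLength_eq, orbitLength]
  rw [zero_add] at l₁
  by_cases hc : mirror n x = 1 - x
  · rw [hc, sub_sub_cancel] at l₁
    obtain ⟨rfl, e⟩ := h.eq_of_mem_curve l₁ (hz.mem_curve _) (hz.mem_curve _)
    have hp : period z = 3 * bounces n x := period_eq (by omega) e.symm fun j hj hj' => by
      simpa using ne_of_round hz hx hx h h hj hj'
    rw [if_pos hc, hp, e₁, hc]
    exact ⟨by ring, le_rfl⟩
  · have hx' := (hx.mirror n).one_sub
    have hb : bounces n (1 - mirror n x) = bounces n x := by
      rw [bounces_one_sub (hx.mirror n), bounces_mirror hx]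
    have hm : mirror n (1 - mirror n x) = 1 - x := by
      rw [mirror_one_sub (hx.mirror n), mirror_mirror hx]
    have hD : excess n (1 - mirror n x) = excess n x := by
      rw [excess_one_sub (hx.mirror n), excess_mirror hx]
    obtain ⟨τ₂, l₂, -, -, -, e₂⟩ := round hz hx' l₁
    rw [hb, hm, hD] at e₂
    rw [hb, hm, sub_sub_cancel] at l₂
    obtain ⟨rfl, e⟩ := h.eq_of_mem_curve l₂ (hz.mem_curve _) (hz.mem_curve _)
    have hp : period z = 3 * bounces n x + 3 * bounces n x := by
      refine period_eq (by omega) e.symm fun j hj hj' => ?_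
      rcases lt_trichotomy j (3 * bounces n x) with h1 | rfl | h1
      · simpa using ne_of_round hz hx hx h h hj h1
      -- Recurrence exactly after one turn would make the two feet coincide, since the basepoint and
      -- the direction determine the foot.
      · intro e'
        have e3 : pt base (1 - mirror n x - τ₁) τ₁ = pt base (x - τ) τ := by
          rw [← l₁.coord, ← h.coord, e']
        obtain ⟨h2, h3⟩ := pt_inj (sides_sub_ne_zero base_mem) e3
        exact hc (by linarith)
      · have := ne_of_round hz hx hx' h l₁ (i := j - 3 * bounces n x) (by omega)
          (by rw [hb]; omega)
        rwa [show 3 * bounces n x + (j - 3 * bounces n x) = j by omega] at this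
    rw [if_neg hc, hp, flightLength_add, e₁, zero_add, e₂]
    exact ⟨by ring, by omega⟩

/-! ### The common foot of the initial flights -/

/-- A point of the base that lies on `KS_n` lies on a side of `KS_n` with the same direction. -/
lemma exists_side_of_mem_curve (k : ℕ) {m : ℕ} {s : ℂ × ℂ} (hs : s ∈ sides m) {u : ℝ}
    (hu : NonTriadic u) (hc : pt s u 0 ∈ curve (m + k)) :
    ∃ s' ∈ sides (m + k), ∃ u', 0 < u' ∧ u' < 1 ∧ pt s u 0 = pt s' u' 0 ∧
      ∀ a b, dir s' (m + k) a b = dir s m a b := by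
  induction k generalizing m s u with
  | zero => exact ⟨s, hs, u, hu.1, hu.2.1, rfl, fun _ _ => rfl⟩
  | succ k ih =>
    have e : m + (k + 1) = m + 1 + k := by ring
    rw [e] at hc ⊢
    obtain ⟨v, hv, rfl | rfl | rfl⟩ := hu.exists_digit
    · have hp : pt s (v / 3) 0 = pt (child₁ s) v 0 := by rw [pt_child₁, zero_div]
      rw [hp] at hc ⊢
      obtain ⟨s', hs', u', h0, h1, h2, h3⟩ := ih (child₁_mem hs) hv hc
      exact ⟨s', hs', u', h0, h1, h2, fun a b => by rw [h3, dir_child₁]⟩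
    · refine absurd hc (notMem_curve_of_mem_halfOpenCell (by omega) hs ⟨_, _, rfl, le_rfl, ?_, ?_⟩)
      · linarith [hv.1]
      · linarith [hv.2.1]
    · have hp : pt s ((2 + v) / 3) 0 = pt (child₄ s) v 0 := by rw [pt_child₄, zero_div]
      rw [hp] at hc ⊢
      obtain ⟨s', hs', u', h0, h1, h2, h3⟩ := ih (child₄_mem hs) hv hc
      exact ⟨s', hs', u', h0, h1, h2, fun a b => by rw [h3, dir_child₄]⟩

/-- A segment inside the table cannot reach the base from below at a point of `KS_n`. -/
lemma notMem_curve_of_reached_from_below {n : ℕ} {p : ℂ} {x t : ℝ} (hx : NonTriadic x) (ht : 0 < t)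
    (hp : p + (t : ℂ) * dirPiThird = pt base x 0)
    (htable : ∀ r ∈ Set.Ioo 0 t, p + (r : ℂ) * dirPiThird ∈ table n) : pt base x 0 ∉ curve n := by
  intro hc
  obtain ⟨s, hs, u, h0, h1, hu, hd⟩ := exists_side_of_mem_curve n base_mem hx (by rwa [zero_add])
  rw [zero_add] at hs hd
  have h3 : (0 : ℝ) < 3 ^ n := by positivity
  -- Going back from the foot by `r` gives the frame point `(u - r * 3 ^ n, r * 3 ^ n)`. The two
  -- bounds on `r` put it in the open hull of the side, hence outside the table.
  obtain ⟨r, hr0, hr⟩ := exists_between (show 0 < min t (min (u / 2) (1 - u) / 3 ^ n) by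
    have : 0 < 1 - u := by linarith
    positivity)
  obtain ⟨hrt, hr⟩ := lt_min_iff.mp hr
  rw [lt_div_iff₀ h3] at hr
  obtain ⟨hr1, hr2⟩ := lt_min_iff.mp hr
  have hpos := mul_pos hr0 h3
  refine notMem_table_of_mem_openHull hs ⟨u - r * 3 ^ n, r * 3 ^ n, ?_, hpos, by linarith,
    by linarith⟩ (htable (t - r) ⟨by linarith, by linarith⟩)
  have e : pt s u 0 + ((-r : ℝ) : ℂ) * dir s n 1 (-1) = pt s (u - r * 3 ^ n) (r * 3 ^ n) := by
    rw [pt_add_dir]; congr 1 <;> ring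
  rw [← e, ← hu, ← hp, hd, ← dirPiThird_eq_dir]
  push_cast; ring

/-- From the right side the direction `π/3` points out of the triangle, and on the left side it runs
along the boundary. Only the base remains. -/
lemma start_mem_base {z : ℕ → ℂ × ℂ} (hz : IsOrbit 0 z) (hd : (z 0).2 = dirPiThird) :
    ∃ x : ℝ, 0 < x ∧ x < 1 ∧ (z 0).1 = pt base x 0 := by
  obtain ⟨s, hs, hm⟩ := hz.start_mem
  obtain ⟨u, h0, h1, hu⟩ := mem_openSegment_iff.mp hm
  obtain ⟨⟨t, ht, -, hfree⟩, -⟩ := hz.step 0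
  rw [hd, dirPiThird_eq_dir, hu] at hfree
  rcases mem_sides_zero.mp hs with rfl | rfl | rfl
  · exact ⟨u, h0, h1, hu⟩
  · exfalso
    obtain ⟨x, y, hxy, -, hx, -⟩ := table_zero_coord (hfree (t / 2) ⟨by linarith, by linarith⟩).1
    rw [pt_rightSide, pt_add_dir] at hxy
    obtain ⟨e, -⟩ := pt_inj (sides_sub_ne_zero base_mem) hxy
    norm_num at e
    linarith
  · exfalso
    obtain ⟨r, hr0, hr⟩ := exists_between (lt_min ht h0)
    obtain ⟨hrt, hru⟩ := lt_min_iff.mp hr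
    refine (hfree r ⟨hr0, hrt⟩).2 (mem_curve_of_mem_openSegment leftSide_mem
      (mem_openSegment_iff.mpr ⟨u - r, by linarith, by linarith, ?_⟩))
    rw [pt_leftSide, pt_leftSide, pt_add_dir]
    congr 1 <;> simp <;> ring

/-- The foot of a `π/3`-ray that starts at the midpoint of a side of `KS_n` is a half-integral
multiple of `3 ^ (-n)`. -/
lemma half_of_midpoint {n : ℕ} {z : ℕ → ℂ × ℂ} (hz : IsOrbit n z) (hd : (z 0).2 = dirPiThird)
    {s : ℂ × ℂ} (hs : s ∈ sides n) (hm : (z 0).1 = midpoint ℝ s.1 s.2) {x t : ℝ}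
    (hx : (z 0).1 + (t : ℂ) * dirPiThird = pt base x 0) :
    ∃ a : ℤ, (3 : ℝ) ^ n * x = a + 1 / 2 := by
  obtain ⟨p, q, a, b, h1, h2, h3⟩ := sides_lattice hs
  have hm' : (z 0).1 = pt s (1 / 2) 0 := by
    rw [hm, midpoint_eq_smul_add]; simp [pt]; ring
  -- Motion in the direction `1 - eta` preserves the sum of the two coordinates, so `3 ^ n * x = p +
  -- q + (a + b) / 2`. It remains to see that `a + b` is odd.
  have key : (((p + a / 2 : ℝ) : ℝ) : ℂ) + ((q + b / 2 : ℝ) : ℂ) * eta =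
      ((3 ^ n * (x - t) : ℝ) : ℂ) + ((3 ^ n * t : ℝ) : ℂ) * eta := by
    rw [hm', pt_base, dirPiThird_eq_one_sub_eta, pt] at hx
    push_cast at *
    linear_combination 3 ^ n * hx - h1 - h2 / 2
  obtain ⟨k1, k2⟩ := ofReal_add_mul_eta_inj key
  rcases Int.even_or_odd' (a + b) with ⟨c, hc | hc⟩
  -- If `a + b` is even, the norm form forces `a + b = 0`. The side is then parallel to the ray and
  -- the ball would slide along it.
  · exfalso
    have hc0 : c = 0 := by
      obtain rfl : a = 2 * c - b := by omega
      by_contra hne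
      have : 1 ≤ c ^ 2 := by
        have := sq_nonneg c
        have : c ^ 2 ≠ 0 := pow_ne_zero 2 hne
        omega
      nlinarith [sq_nonneg (c - b)]
    obtain rfl : b = -a := by omega
    have ha : a ^ 2 = 1 := by linarith
    have hdir : dirPiThird = dir s n a 0 := by
      have ha' : (a : ℂ) ^ 2 = 1 := by exact_mod_cast ha
      rw [dir, h2, dirPiThird_eq_one_sub_eta]; push_cast
      linear_combination (eta - 1) * ha'
    obtain ⟨⟨t', ht', -, hfree⟩, -⟩ := hz.step 0
    have hp3 : (0 : ℝ) < 3 ^ n := by positivity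
    obtain ⟨r, hr0, hr⟩ := exists_between (show 0 < min t' (1 / 2 / 3 ^ n) by positivity)
    obtain ⟨hrt, hru⟩ := lt_min_iff.mp hr
    rw [lt_div_iff₀ hp3] at hru
    have hpos := mul_pos hr0 hp3
    refine (hfree r ⟨hr0, hrt⟩).2 (mem_curve_of_mem_openSegment hs ?_)
    rw [hd, hm', hdir, pt_add_dir, mul_zero, add_zero]
    refine mem_openSegment_iff.mpr ⟨_, ?_, ?_, rfl⟩ <;>
    · rcases mul_self_eq_one_iff.mp (by linarith : a * a = 1) with rfl | rfl <;> push_cast <;> linarith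
  · refine ⟨p + q + c, ?_⟩
    have : (a : ℝ) + b = 2 * c + 1 := by exact_mod_cast hc
    push_cast
    linarith

/-! ### Monotonicity and bound of the length -/

lemma orbitLength_zero_le {x : ℝ} : orbitLength 0 x ≤ 3 := by
  rw [orbitLength]; split_ifs <;> norm_num [excess]

lemma orbitLength_of_ne {x : ℝ} (h : ∀ n, mirror n x ≠ 1 - x) (n : ℕ) :
    orbitLength n x = 3 + 3 * excess n x := if_neg (h n)

/-- The first digit of `x` decides. For 0 or 2, `mirror` keeps `x` in its outer third, so there are
always two turns, and the excess is at most 1. For 1, one turn suffices from level 1 on and the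
length is 3 plus the excess of the remaining digits, which is at most 3. A drop from two turns to
one can only occur at level 0, where the length is at most 3. -/
lemma orbitLength_mono_le {x : ℝ} (hx : NonTriadic x) :
    (Monotone fun n => orbitLength n x) ∧ ∀ n, orbitLength n x ≤ 6 := by
  have outer : (∀ n, mirror n x ≠ 1 - x) → (∀ n, excess n x ≤ 1) →
      (Monotone fun n => orbitLength n x) ∧ ∀ n, orbitLength n x ≤ 6 := by
    intro h h'
    simp only [orbitLength_of_ne h]
    exact ⟨monotone_nat_of_le_succ fun n => by linarith [excess_le_succ n x],
      fun n => by linarith [h' n]⟩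
  obtain ⟨v, hv, rfl | rfl | rfl⟩ := hx.exists_digit
  · apply outer <;> rintro (_ | n)
    · rw [mirror]; linarith [hv.2.1]
    · rw [mirror_cons_zero hv]; linarith [(hv.mirror n).2.1, hv.2.1]
    · simp [excess]
    · rw [excess_cons_zero hv]; linarith [excess_le n v]
  · have e : ∀ n, orbitLength (n + 1) ((1 + v) / 3) = 3 + excess n v := by
      intro n
      rw [orbitLength, if_pos (by rw [mirror_cons_one hv]; ring), excess_cons_one hv]
      ring
    refine ⟨monotone_nat_of_le_succ ?_, ?_⟩ <;> rintro (_ | n)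
    · rw [e]; linarith [orbitLength_zero_le (x := (1 + v) / 3), excess_nonneg 0 v]
    · rw [e, e]; linarith [excess_le_succ n v]
    · linarith [orbitLength_zero_le (x := (1 + v) / 3)]
    · rw [e]; linarith [excess_le n v]
  · apply outer <;> rintro (_ | n)
    · rw [mirror]; linarith [hv.1]
    · rw [mirror_cons_two hv]; linarith [(hv.mirror n).1, hv.1]
    · simp [excess]
    · rw [excess_cons_two hv]; linarith [excess_le n v]

lemma pathLength_fagnano {F : ℕ → ℂ × ℂ} (hF : IsFagnanoOrbit F) : pathLength F = 3 / 2 := by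
  obtain ⟨⟨hz, -⟩, h0⟩ := hF
  have hx : NonTriadic (1 / 2) :=
    nonTriadic_of_half (m := 0) (a := 0) (by norm_num) (by norm_num) (by norm_num)
  have hl : Leaves 0 F 0 0 (pt base (1 / 2) 0) (dir base 0 1 (-1)) :=
    ⟨le_rfl, by rw [h0, dirPiThird_eq_dir], by rw [h0, pt_base]; simp,
      fun r hr => absurd hr.1 (not_lt.mpr hr.2)⟩
  rw [(pathLength_period hz hx hl).1, orbitLength, if_pos (by rw [mirror]; norm_num), excess]
  norm_num

/-- The initial flights of a compatible piecewise Fagnano sequence all pass through the same point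
of the base, whose parameter is a half-integral multiple of a power of `1 / 3`. -/
lemma IsCompatiblePiecewiseFagnano.exists_leaves {O : ℕ → ℕ → ℂ × ℂ}
    (hO : IsCompatiblePiecewiseFagnano dirPiThird O) :
    ∃ (x : ℝ) (m : ℕ) (a : ℤ), NonTriadic x ∧ (3 : ℝ) ^ m * x = a + 1 / 2 ∧
      ∀ n, ∃ τ, Leaves n (O n) 0 τ (pt base x 0) (dir base 0 1 (-1)) := by
  obtain ⟨x, h0, h1, hx⟩ := start_mem_base (hO.periodic 0).1 (hO.direction 0)
  obtain ⟨N, hN⟩ := hO.midpoints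
  obtain ⟨s, hs, hm⟩ := hN N le_rfl
  obtain ⟨t, -, ht, -⟩ := hO.collinear (N + 1)
  rw [hx] at ht
  obtain ⟨a, ha⟩ : ∃ a : ℤ, (3 : ℝ) ^ (N + 1) * x = a + 1 / 2 := by
    rcases hm with hm | hm
    · exact half_of_midpoint (hO.periodic _).1 (hO.direction _) (child₂_mem hs) hm ht
    · exact half_of_midpoint (hO.periodic _).1 (hO.direction _) (child₃_mem hs) hm ht
  have hnt := nonTriadic_of_half h0 h1 ha
  refine ⟨x, N + 1, a, hnt, ha, fun n => ?_⟩
  obtain ⟨τ, hτ, he, hfree⟩ := hO.collinear n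
  rw [hx] at he
  refine ⟨τ, hτ, by rw [hO.direction, dirPiThird_eq_dir], by rw [← dirPiThird_eq_dir, he],
    fun r hr => ?_⟩
  rw [← dirPiThird_eq_dir]
  rcases hr.2.lt_or_eq with hlt | rfl
  · exact (hfree r ⟨hr.1, hlt⟩).2
  -- For a flight of positive duration the foot itself must be off `KS_n`. For `τ = 0` there is
  -- nothing to check.
  · rw [he]
    exact notMem_curve_of_reached_from_below hnt hr.1 he fun r' hr' => (hfree r' hr').1

end

end KochBilliard

/-! ### Conclusion -/

theorem mainTheorem7 (O : ℕ → ℕ → ℂ × ℂ)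
    (hO : KochBilliard.IsCompatiblePiecewiseFagnano KochBilliard.dirPiThird O)
    (F : ℕ → ℂ × ℂ) (hF : KochBilliard.IsFagnanoOrbit F) :
    Monotone (fun n => KochBilliard.pathLength (O n)) ∧
    (∃ l : ℝ, Tendsto (fun n => KochBilliard.pathLength (O n)) atTop (𝓝 l) ∧
      l ≤ 4 * KochBilliard.pathLength F) ∧
    Tendsto (fun n => KochBilliard.period (O n)) atTop atTop := by
  obtain ⟨x, m, a, hx, ha, hl⟩ := hO.exists_leaves
  choose τ hτ using hl
  have key := fun n => KochBilliard.pathLength_period (hO.periodic n).1 hx (hτ n)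
  obtain ⟨hmono, hle⟩ := KochBilliard.orbitLength_mono_le hx
  simp only [fun n => (key n).1]
  refine ⟨hmono, ⟨⨆ n, KochBilliard.orbitLength n x, tendsto_atTop_ciSup hmono ⟨6, ?_⟩, ?_⟩, ?_⟩
  · rintro _ ⟨n, rfl⟩
    exact hle n
  · rw [KochBilliard.pathLength_fagnano hF]
    exact ciSup_le fun n => (hle n).trans (by norm_num)
  -- At level `m + k` with `k ≥ b` the period is at least `3 * 2 ^ k`, which exceeds `b`.
  · refine tendsto_atTop.mpr fun b => eventually_atTop.mpr ⟨m + b, fun n hn => ?_⟩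
    obtain ⟨k, rfl⟩ := Nat.exists_eq_add_of_le (show m ≤ n by omega)
    have h1 := KochBilliard.two_pow_le_bounces hx ha k
    have h2 := (key (m + k)).2
    have h3 : k < 2 ^ k := Nat.lt_two_pow_self
    omega
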